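/- For a closed immersed plane curve $c:\mathbb{S}^1\to\mathbb{R}^2$ with unit normal field $\nu$ (either choice of orientation), arc-length $s$ and curvature $k=\langle c_{ss},\nu\rangle$, let $L(c)=\int_c ds$, $A(c)=-\tfrac12\int_c\langle c,\nu\rangle\,ds$, $I(c)=L^2/(4\pi A)$ and $K_{osc}(c)=L\int_c(k-\bar k)^2\,ds$, where $\bar k=\tfrac1L\int_c k\,ds$. Let \[ K_0=\frac{2\pi+12\pi^2-4\pi\sqrt{3\pi}\sqrt{1+3\pi}}{3}. \] Then $0<K_0<64-4\pi^2$, and for every $K^*\le K_0$ the following holds. Let $\gamma_0:\mathbb{S}^1\to\mathbb{R}^2$ be a regular smooth immersed closed curve with \[ A(\gamma_0)>0,\qquad \int_{\gamma_0}k\,ds=2\pi,\qquad K_{osc}(\gamma_0)<K^*,\qquad I(\gamma_0)<\exp\Big(\frac{K^*}{8\pi^2}\Big), \] and let $\gamma:\mathbb{S}^1\times[0,T)\to\mathbb{R}^2$, $0<T\le\infty$, be a curve diffusion flow with $\gamma(\cdot,0)=\gamma_0$, that is, a family of smooth closed immersed curves, jointly smooth for $t>0$ and continuous up to $t=0$ together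 with its first two spatial derivatives, whose normal velocity is $\partial_t^\perp\gamma=-k_{ss}$ for $t\in(0,T)$. Then $\gamma(\cdot,t)$ is embedded for every $t\in[0,T)$. -/

import Mathlib

open scoped ContDiff

namespace CurveDiffusion

noncomputable section

/-- The Euclidean plane. -/
abbrev Plane := EuclideanSpace ℝ (Fin 2)

/-- Rotation of the plane by `+π/2`. -/
def rot (v : Plane) : Plane := !₂[-v 1, v 0]

/-- `|c_u|`, the speed of a parametrised curve; `ds = |c_u| du`. -/
def speed (c : ℝ → Plane) (u : ℝ) : ℝ := ‖deriv c u‖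

/-- The arc-length derivative `f_s = |c_u|⁻¹ f_u` of a function `f` along the curve `c`. -/
def arcDeriv {E : Type*} [NormedAddCommGroup E] [NormedSpace ℝ E]
    (c : ℝ → Plane) (f : ℝ → E) (u : ℝ) : E :=
  (speed c u)⁻¹ • deriv f u

/-- The integral `∫_c f ds` over one period `[0, P]`. -/
def arcIntegral (P : ℝ) (c : ℝ → Plane) (f : ℝ → ℝ) : ℝ :=
  ∫ u in (0 : ℝ)..P, f u * speed c u

/-- The unit tangent `τ = c_s`. -/
def tangent (c : ℝ → Plane) : ℝ → Plane := arcDeriv c c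

/-- The unit normal field `ν = ± rot τ`; the sign `ε` is the choice of orientation of `ν`. With
`ε = 1` it is the inward normal of a counterclockwise circle. -/
def normal (ε : ℤˣ) (c : ℝ → Plane) (u : ℝ) : Plane :=
  (((ε : ℤ) : ℝ)) • rot (tangent c u)

/-- The curvature `k = ⟨c_ss, ν⟩`. -/
def curvature (ε : ℤˣ) (c : ℝ → Plane) (u : ℝ) : ℝ :=
  inner ℝ (arcDeriv c (tangent c) u) (normal ε c u)

/-- The length `L`. -/
def length (P : ℝ) (c : ℝ → Plane) : ℝ := ∫ u in (0 : ℝ)..P, speed c u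

/-- The signed enclosed area `A = -½ ∫ ⟨c, ν⟩ ds`. -/
def signedArea (ε : ℤˣ) (P : ℝ) (c : ℝ → Plane) : ℝ :=
  -(1 / 2) * arcIntegral P c (fun u => inner ℝ (c u) (normal ε c u))

/-- The average curvature. -/
def avgCurvature (ε : ℤˣ) (P : ℝ) (c : ℝ → Plane) : ℝ :=
  (1 / length P c) * arcIntegral P c (curvature ε c)

/-- The normalised oscillation of curvature `K_osc = L ∫ (k - k_av)² ds`. -/
def oscCurvature (ε : ℤˣ) (P : ℝ) (c : ℝ → Plane) : ℝ :=
  length P c * arcIntegral P c (fun u => (curvature ε c u - avgCurvature ε P c) ^ 2)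

/-- The isoperimetric ratio `I = L² / (4πA)`. -/
def isoRatio (ε : ℤˣ) (P : ℝ) (c : ℝ → Plane) : ℝ :=
  length P c ^ 2 / (4 * Real.pi * signedArea ε P c)

/-- A regular smooth immersed closed curve `c : ℝ / Pℤ → ℝ²`, given by its `P`-periodic lift. -/
structure IsClosedImmersedCurve (P : ℝ) (c : ℝ → Plane) : Prop where
  period_pos : 0 < P
  periodic : Function.Periodic c P
  smooth : ContDiff ℝ ∞ c
  regular : ∀ u, deriv c u ≠ 0

/-- An embedded closed curve: an immersion of the circle `ℝ / Pℤ` that is injective. As the circle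
is compact, it is then a homeomorphism onto its image. -/
structure IsEmbeddedCurve (P : ℝ) (c : ℝ → Plane) : Prop where
  immersed : IsClosedImmersedCurve P c
  injective : Set.InjOn c (Set.Ico 0 P)

/-- `γ : (ℝ / Pℤ) × [0, T) → ℝ²`, `(u, t) ↦ γ t u`, with `0 < T ≤ ∞`, is a curve diffusion flow:
every `γ t` is a closed immersed curve, `γ` is smooth for positive times, it attains its initial
curve in `C²` (a family that is smooth on all of `[0, T)` in particular), and its
normal velocity is `-k_ss`. Nothing is required of the tangential velocity. -/
structure IsCurveDiffusionFlow (ε : ℤˣ) (P : ℝ) (T : EReal) (γ : ℝ → ℝ → Plane) : Prop where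
  time_pos : 0 < T
  immersed : ∀ t : ℝ, 0 ≤ t → (t : EReal) < T → IsClosedImmersedCurve P (γ t)
  smooth : ContDiffOn ℝ ∞ (fun p : ℝ × ℝ => γ p.1 p.2)
    ({t : ℝ | 0 < t ∧ (t : EReal) < T} ×ˢ Set.univ)
  continuous : ∀ j : ℕ, j ≤ 2 → ContinuousOn (fun p : ℝ × ℝ => iteratedDeriv j (γ p.1) p.2)
    ({t : ℝ | 0 ≤ t ∧ (t : EReal) < T} ×ˢ Set.univ)
  normal_velocity : ∀ t : ℝ, 0 < t → (t : EReal) < T → ∀ u : ℝ,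
    inner ℝ (deriv (fun r => γ r u) t) (normal ε (γ t) u)
      = -arcDeriv (γ t) (arcDeriv (γ t) (curvature ε (γ t))) u

/-- The admissible initial curves with constant `K`: regular smooth immersed closed curves with
`A > 0`, `∫ k ds = 2π`, `K_osc < K` and `I < exp (K / 8π²)`. -/
structure IsAdmissibleInitialCurve (ε : ℤˣ) (P K : ℝ) (c : ℝ → Plane) : Prop where
  immersed : IsClosedImmersedCurve P c
  area_pos : 0 < signedArea ε P c
  total_curvature : arcIntegral P c (curvature ε c) = 2 * Real.pi
  osc_lt : oscCurvature ε P c < K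
  iso_lt : isoRatio ε P c < Real.exp (K / (8 * Real.pi ^ 2))

/-- The explicit constant `K* = (2π + 12π² - 4π √(3π) √(1 + 3π)) / 3`. -/
def Kstar : ℝ :=
  (2 * Real.pi + 12 * Real.pi ^ 2
    - 4 * Real.pi * Real.sqrt (3 * Real.pi) * Real.sqrt (1 + 3 * Real.pi)) / 3

end

end CurveDiffusion

/-!
The proof controls `K_osc` along the flow and excludes self-intersections when it is small.

*Small `K_osc` forces embeddedness.* A closed curve with a self-intersection splits into two loops,
each starting and ending at the double point. Along a loop, up to its first return, the cosine of
the angle between the tangent and the ray from the base point runs from `1` to `-1`, while its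
derivative is at least `-r k² / 4`, where the distance `r` to the base point is at most half the
length of the loop. Hence each loop has `ℓ ∫ k² ds ≥ 16` (`sixteen_le_of_loop`), and the two
together give `L ∫ k² ds ≥ 64` (`sixty_four_le_of_self_intersection`). With `∫ k ds = 2π` this
means `K_osc = L ∫ k² ds - 4π² ≥ 64 - 4π² > 24`.

*`K_osc` stays small.* Under the flow, `A` and `∫ k ds` are constant, `L' = -∫ k_s² ds` and
`(∫ k² ds)' = ∫ (-2 k_ss² + 3 k² k_s²) ds`. The tangential velocity is arbitrary, and each identity
is proved pointwise in the form "integrand plus total `u`-derivative" (`FlowData`), so that only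
periodicity is needed to integrate it. Expanding `k` around its mean and using
`sup f² ≤ (L / 4) ∫ f_s² ds` for functions of mean zero shows that `K_osc + 8π² log L` is
nonincreasing as long as `K_osc ≤ 1/9` (`curvature_interpolation`). The isoperimetric inequality
`4πA ≤ L²` and the conservation of `A` bound the decrease of `8π² log L` by `4π² log I(γ₀) < K / 2`.
As `K ≤ 1/18`, a continuity argument gives `K_osc < 1/9` for all times
(`IsCurveDiffusionFlow.oscCurvature_lt`).
-/

namespace CurveDiffusion

/-! ### Interpolation inequalities on a closed curve -/

/-- The integral over a period of the derivative of a function with equal values at the ends. -/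
theorem integral_eq_zero_of_hasDerivAt_of_eq {P : ℝ} {f f' : ℝ → ℝ}
    (hf : ∀ u, HasDerivAt f (f' u) u) (hf' : Continuous f') (hP : f P = f 0) :
    ∫ u in (0 : ℝ)..P, f' u = 0 := by
  rw [intervalIntegral.integral_eq_sub_of_hasDerivAt (fun u _ => hf u)
    (hf'.intervalIntegrable _ _), hP, sub_self]

theorem integral_eq_of_eq_linear_combination {P : ℝ} {F f g h : ℝ → ℝ} (a b c : ℝ)
    (hf : Continuous f) (hg : Continuous g) (hh : Continuous h)
    (hF : ∀ u, F u = a * f u + b * g u + c * h u) :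
    ∫ u in (0 : ℝ)..P, F u = a * (∫ u in (0 : ℝ)..P, f u) + b * (∫ u in (0 : ℝ)..P, g u)
      + c * ∫ u in (0 : ℝ)..P, h u := by
  simp only [hF]
  rw [intervalIntegral.integral_add, intervalIntegral.integral_add,
    intervalIntegral.integral_const_mul, intervalIntegral.integral_const_mul,
    intervalIntegral.integral_const_mul]
  all_goals exact Continuous.intervalIntegrable (by fun_prop) _ _

/-- The Cauchy-Schwarz inequality `(∫ g ds)² ≤ L ∫ g² ds`. -/
theorem sq_integral_mul_le {P : ℝ} (hP : 0 < P) {v g : ℝ → ℝ} (hv : Continuous v)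
    (hg : Continuous g) (hv0 : ∀ u, 0 < v u) :
    (∫ u in (0 : ℝ)..P, g u * v u) ^ 2
      ≤ (∫ u in (0 : ℝ)..P, v u) * ∫ u in (0 : ℝ)..P, g u ^ 2 * v u := by
  have hL : 0 < ∫ u in (0 : ℝ)..P, v u :=
    intervalIntegral.intervalIntegral_pos_of_pos (hv.intervalIntegrable _ _) hv0 hP
  set L := ∫ u in (0 : ℝ)..P, v u with hLdef
  set G := ∫ u in (0 : ℝ)..P, g u * v u with hG
  have h1 : 0 ≤ ∫ u in (0 : ℝ)..P, (L * g u - G) ^ 2 * v u :=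
    intervalIntegral.integral_nonneg hP.le fun u _ => mul_nonneg (sq_nonneg _) (hv0 u).le
  have h2 : ∫ u in (0 : ℝ)..P, (L * g u - G) ^ 2 * v u
      = L ^ 2 * (∫ u in (0 : ℝ)..P, g u ^ 2 * v u) + (-2 * L * G) * G + G ^ 2 * L := by
    exact integral_eq_of_eq_linear_combination _ _ _ (by fun_prop) (by fun_prop) hv
      fun u => by ring
  have h3 : 0 ≤ L * (L * (∫ u in (0 : ℝ)..P, g u ^ 2 * v u) - G ^ 2) := by
    rw [h2] at h1; linarith
  have := nonneg_of_mul_nonneg_right h3 hL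
  linarith

theorem exists_eq_zero_of_integral_mul_eq_zero {P : ℝ} (hP : 0 < P) {v f : ℝ → ℝ}
    (hv : Continuous v) (hf : Continuous f) (hv0 : ∀ u, 0 < v u)
    (h : ∫ u in (0 : ℝ)..P, f u * v u = 0) : ∃ x ∈ Set.Icc 0 P, f x = 0 := by
  by_contra! hne
  have key : (∀ x ∈ Set.Icc 0 P, 0 < f x) ∨ ∀ x ∈ Set.Icc 0 P, f x < 0 := by
    by_contra! hcon
    obtain ⟨⟨x, hx, hx0⟩, y, hy, hy0⟩ := hcon
    obtain ⟨z, hz, hz0⟩ := isPreconnected_Icc.intermediate_value hx hy hf.continuousOn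
      (show (0 : ℝ) ∈ Set.Icc (f x) (f y) from ⟨hx0, hy0⟩)
    exact hne z hz hz0
  rcases key with hpos | hneg
  · have := intervalIntegral.intervalIntegral_pos_of_pos_on
      ((hf.mul hv).intervalIntegrable 0 P)
      (fun x hx => mul_pos (hpos x (Set.Ioo_subset_Icc_self hx)) (hv0 x)) hP
    exact this.ne' h
  · have := intervalIntegral.intervalIntegral_pos_of_pos_on
      ((hf.mul hv).neg.intervalIntegrable 0 P)
      (fun x hx => neg_pos.2 <|
        mul_neg_of_neg_of_pos (hneg x (Set.Ioo_subset_Icc_self hx)) (hv0 x)) hP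
    simp only [Pi.neg_apply, Pi.mul_apply, intervalIntegral.integral_neg, h] at this
    simp at this

/-- Sobolev inequality on a circle of length `∫ v`: a function of mean zero satisfies
`sup f² ≤ (L / 4) ∫ f_s² ds`. Both arcs from a zero of `f` to the given point are used, which
accounts for the constant `1 / 4`. -/
theorem sq_le_of_integral_mul_eq_zero {P : ℝ} (hP : 0 < P) {v f g : ℝ → ℝ}
    (hv : Continuous v) (hg : Continuous g) (hv0 : ∀ u, 0 < v u)
    (hf : ∀ u, HasDerivAt f (g u * v u) u) (hfP : f P = f 0)
    (h : ∫ u in (0 : ℝ)..P, f u * v u = 0) {u : ℝ} (hu : u ∈ Set.Icc 0 P) :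
    f u ^ 2 ≤ (∫ u in (0 : ℝ)..P, v u) / 4 * ∫ u in (0 : ℝ)..P, g u ^ 2 * v u := by
  have hfc : Continuous f := continuous_iff_continuousAt.2 fun u => (hf u).continuousAt
  obtain ⟨x, hx, hx0⟩ := exists_eq_zero_of_integral_mul_eq_zero hP hv hfc hv0 h
  have hga : Continuous fun u => |g u| * v u := by fun_prop
  have step : ∀ {p q : ℝ}, p ≤ q → |f q - f p| ≤ ∫ w in p..q, |g w| * v w := fun {p q} hpq => by
    rw [← intervalIntegral.integral_eq_sub_of_hasDerivAt (fun u _ => hf u)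
      ((hg.mul hv).intervalIntegrable _ _)]
    refine (intervalIntegral.abs_integral_le_integral_abs hpq).trans_eq ?_
    simp only [abs_mul, abs_of_pos (hv0 _)]
  have split : ∀ {p q : ℝ}, (∫ w in (0 : ℝ)..p, |g w| * v w) + (∫ w in p..q, |g w| * v w)
      + (∫ w in q..P, |g w| * v w) = ∫ w in (0 : ℝ)..P, |g w| * v w := fun {p q} => by
    rw [intervalIntegral.integral_add_adjacent_intervals (hga.intervalIntegrable _ _)
      (hga.intervalIntegrable _ _), intervalIntegral.integral_add_adjacent_intervals
      (hga.intervalIntegrable _ _) (hga.intervalIntegrable _ _)]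
  have h2 : 2 * |f u| ≤ ∫ w in (0 : ℝ)..P, |g w| * v w := by
    rcases le_total x u with hxu | hxu
    · have a1 := step hx.1
      have a2 := step hxu
      have a3 := step hu.2
      have := split (p := x) (q := u)
      rw [hx0] at a1 a2
      rw [hfP] at a3
      rcases abs_cases (f u) with h' | h' <;> rcases abs_le.1 a1 <;> rcases abs_le.1 a2 <;>
        rcases abs_le.1 a3 <;> linarith
    · have a1 := step hu.1
      have a2 := step hxu
      have a3 := step hx.2
      have := split (p := u) (q := x)
      rw [hx0] at a2 a3
      rw [hfP] at a3
      rcases abs_cases (f u) with h' | h' <;> rcases abs_le.1 a1 <;> rcases abs_le.1 a2 <;>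
        rcases abs_le.1 a3 <;> linarith
  have h3 := sq_integral_mul_le hP hv hg.abs hv0
  simp only [sq_abs] at h3
  have h4 := pow_le_pow_left₀ (by positivity) h2 2
  rw [mul_pow, sq_abs] at h4
  linarith

/-- The integral of `(k - I / L)²` in terms of those of `k²` and `k`. -/
theorem length_mul_integral_sub_sq {P : ℝ} {v k : ℝ → ℝ} (hv : Continuous v)
    (hk : Continuous k) (hL : (∫ u in (0 : ℝ)..P, v u) ≠ 0) :
    (∫ u in (0 : ℝ)..P, v u) * (∫ u in (0 : ℝ)..P,
      (k u - (∫ u in (0 : ℝ)..P, k u * v u) / ∫ u in (0 : ℝ)..P, v u) ^ 2 * v u)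
    = (∫ u in (0 : ℝ)..P, v u) * (∫ u in (0 : ℝ)..P, k u ^ 2 * v u)
      - (∫ u in (0 : ℝ)..P, k u * v u) ^ 2 := by
  generalize hm : (∫ u in (0 : ℝ)..P, k u * v u) / (∫ u in (0 : ℝ)..P, v u) = m
  rw [integral_eq_of_eq_linear_combination (F := fun u => (k u - m) ^ 2 * v u)
    (f := fun u => k u ^ 2 * v u) (g := fun u => k u * v u) (h := v) 1 (-2 * m) (m ^ 2)
    (by fun_prop) (by fun_prop) hv fun u => by ring, ← hm]
  field_simp
  ring

/-- The final step of `curvature_interpolation`, in terms of the integrals `D = ∫k_s²`,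
`E = ∫k_ss²`, `N = ∫(k - m)²`, `M1 = ∫(k - m)k_s²`, `M2 = ∫(k - m)²k_s²` and `R = ∫(k - m)²k_ss`, where `m` is the
mean of `k`. -/
theorem interpolation_algebra {L I J D E N m M1 M2 R : ℝ} (hL : 0 < L) (hD0 : 0 ≤ D)
    (hE0 : 0 ≤ E) (hN0 : 0 ≤ N) (hmL : m * L = I) (hI : I ^ 2 = 4 * Real.pi ^ 2)
    (hNJ : L * N = L * J - I ^ 2) (hLN : L * N ≤ 1 / 9) (hM2le : M2 ≤ L / 4 * E * N)
    (hM1R : 2 * M1 + R = 0)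
    (hR : I * (-3 * R) ≤ Real.pi / 4 * L * E + 36 * Real.pi / L * (L ^ 3 / 16 * E * N)) :
    -D * J + L * (-2 * E + 3 * M2 + 6 * m * M1 + 3 * m ^ 2 * D) + 8 * Real.pi ^ 2 * (-D / L)
      ≤ 0 := by
  have hmI : m ^ 2 * L = 4 * Real.pi ^ 2 / L := by
    rw [← hI, ← hmL]; field_simp
  rw [hI] at hNJ
  have e1 : 36 * Real.pi / L * (L ^ 3 / 16 * E * N) = 9 * Real.pi / 4 * ((L * N) * (L * E)) := by
    field_simp; ring
  have e2 : -D * J + 12 * Real.pi ^ 2 / L * D + 8 * Real.pi ^ 2 * (-D / L)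
      = - ((L * N) * D / L) := by
    rw [hNJ]; field_simp; ring
  have hLE : 0 ≤ L * E := by positivity
  have b1 : (L * N) * (L * E) ≤ 1 / 9 * (L * E) := mul_le_mul_of_nonneg_right hLN hLE
  have b2 : 0 ≤ (L * N) * D / L := by positivity
  have e3 : L * (3 * M2) ≤ 3 / 4 * ((L * N) * (L * E)) := by
    have := mul_le_mul_of_nonneg_left hM2le (by positivity : 0 ≤ 3 * L)
    linarith
  have e4 : L * (6 * m * M1) = I * (-3 * R) := by
    rw [← hmL]; linear_combination (3 * L * m) * hM1R
  have e5 : L * (3 * m ^ 2 * D) = 12 * Real.pi ^ 2 / L * D := by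
    linear_combination (3 * D) * hmI
  have b3 : Real.pi * (L * E) ≤ 3.15 * (L * E) :=
    mul_le_mul_of_nonneg_right Real.pi_lt_d2.le hLE
  have b4 : 9 * Real.pi / 4 * ((L * N) * (L * E)) ≤ 9 * Real.pi / 4 * (1 / 9 * (L * E)) :=
    mul_le_mul_of_nonneg_left b1 (by positivity)
  linarith

/-- The interpolation inequality behind the monotonicity of `K_osc + 8π² log L`: with
`d = k_s` and `e = k_ss` on a closed curve of total curvature `±2π`, the time derivative
`-∫k_s² ∫k² + L (-2∫k_ss² + 3∫k²k_s²) - 8π² L⁻¹ ∫k_s²` is nonpositive once `K_osc ≤ 1/9`. -/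
theorem curvature_interpolation {P : ℝ} (hP : 0 < P) {v k d e : ℝ → ℝ}
    (hv : Continuous v) (hv0 : ∀ u, 0 < v u) (hec : Continuous e)
    (hk : ∀ u, HasDerivAt k (d u * v u) u) (hd : ∀ u, HasDerivAt d (e u * v u) u)
    (hkP : k P = k 0) (hdP : d P = d 0)
    (hI : (∫ u in (0 : ℝ)..P, k u * v u) ^ 2 = 4 * Real.pi ^ 2)
    (hK : (∫ u in (0 : ℝ)..P, v u) * (∫ u in (0 : ℝ)..P, k u ^ 2 * v u) - 4 * Real.pi ^ 2
      ≤ 1 / 9) :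
    (∫ u in (0 : ℝ)..P, -(d u ^ 2 * v u)) * (∫ u in (0 : ℝ)..P, k u ^ 2 * v u)
      + (∫ u in (0 : ℝ)..P, v u) *
        (∫ u in (0 : ℝ)..P, (-2 * e u ^ 2 * v u + 3 * k u ^ 2 * d u ^ 2 * v u))
      + 8 * Real.pi ^ 2 * ((∫ u in (0 : ℝ)..P, -(d u ^ 2 * v u)) / ∫ u in (0 : ℝ)..P, v u)
      ≤ 0 := by
  have hL : 0 < ∫ u in (0 : ℝ)..P, v u :=
    intervalIntegral.intervalIntegral_pos_of_pos (hv.intervalIntegrable _ _) hv0 hP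
  have hkc : Continuous k := continuous_iff_continuousAt.2 fun u => (hk u).continuousAt
  have hdc : Continuous d := continuous_iff_continuousAt.2 fun u => (hd u).continuousAt
  have hNJ := length_mul_integral_sub_sq hv hkc hL.ne'
  have hmL : (∫ u in (0 : ℝ)..P, k u * v u) / (∫ u in (0 : ℝ)..P, v u)
    * (∫ u in (0 : ℝ)..P, v u) = ∫ u in (0 : ℝ)..P, k u * v u := div_mul_cancel₀ _ hL.ne'
  have hsupd := fun u hu => sq_le_of_integral_mul_eq_zero (u := u) hP hv hec hv0 hd hdP
      (integral_eq_zero_of_hasDerivAt_of_eq hk (hdc.mul hv) hkP) hu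
  generalize hm : (∫ u in (0 : ℝ)..P, k u * v u) / (∫ u in (0 : ℝ)..P, v u) = m at hNJ hmL
  have hsupf0 : ∀ u ∈ Set.Icc 0 P, (k u - m) ^ 2
      ≤ (∫ u in (0 : ℝ)..P, v u) / 4 * ∫ u in (0 : ℝ)..P, d u ^ 2 * v u := fun u hu => by
    refine sq_le_of_integral_mul_eq_zero hP hv hdc hv0 (fun u => (hk u).sub_const m)
      (by rw [hkP]) ?_ hu
    rw [integral_eq_of_eq_linear_combination (f := fun u => k u * v u) (g := v) (h := v) 1 (-m) 0
      (by fun_prop) hv hv fun u => by ring, ← hmL]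
    ring
  have hM : ∫ u in (0 : ℝ)..P, (-2 * e u ^ 2 * v u + 3 * k u ^ 2 * d u ^ 2 * v u)
      = -2 * (∫ u in (0 : ℝ)..P, e u ^ 2 * v u)
        + 3 * (∫ u in (0 : ℝ)..P, (k u - m) ^ 2 * d u ^ 2 * v u)
        + 6 * m * (∫ u in (0 : ℝ)..P, (k u - m) * d u ^ 2 * v u)
        + 3 * m ^ 2 * (∫ u in (0 : ℝ)..P, d u ^ 2 * v u) := by
    rw [integral_eq_of_eq_linear_combination (f := fun u => e u ^ 2 * v u)
        (g := fun u => k u ^ 2 * d u ^ 2 * v u) (h := v) (-2) 3 0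
        (by fun_prop) (by fun_prop) hv fun u => by ring,
      integral_eq_of_eq_linear_combination (F := fun u => k u ^ 2 * d u ^ 2 * v u)
        (f := fun u => (k u - m) ^ 2 * d u ^ 2 * v u)
        (g := fun u => (k u - m) * d u ^ 2 * v u) (h := fun u => d u ^ 2 * v u) 1 (2 * m) (m ^ 2)
        (by fun_prop) (by fun_prop) (by fun_prop) fun u => by ring]
    ring
  -- Integration by parts.
  have hM1R : 2 * (∫ u in (0 : ℝ)..P, (k u - m) * d u ^ 2 * v u)
      + (∫ u in (0 : ℝ)..P, (k u - m) ^ 2 * e u * v u) = 0 := by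
    rw [← intervalIntegral.integral_const_mul, ← intervalIntegral.integral_add
      (Continuous.intervalIntegrable (by fun_prop) _ _)
      (Continuous.intervalIntegrable (by fun_prop) _ _)]
    refine integral_eq_zero_of_hasDerivAt_of_eq (f := fun u => (k u - m) ^ 2 * d u)
      (fun u => ?_) (by fun_prop) (by simp only [hkP, hdP])
    refine ((((hk u).sub_const m).fun_pow 2).mul (hd u)).congr_deriv ?_
    push_cast
    ring
  rw [hM, intervalIntegral.integral_neg]
  have hD0 : 0 ≤ ∫ u in (0 : ℝ)..P, d u ^ 2 * v u :=
    intervalIntegral.integral_nonneg hP.le fun u _ => mul_nonneg (sq_nonneg _) (hv0 u).le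
  have hE0 : 0 ≤ ∫ u in (0 : ℝ)..P, e u ^ 2 * v u :=
    intervalIntegral.integral_nonneg hP.le fun u _ => mul_nonneg (sq_nonneg _) (hv0 u).le
  have hN0 : 0 ≤ ∫ u in (0 : ℝ)..P, (k u - m) ^ 2 * v u :=
    intervalIntegral.integral_nonneg hP.le fun u _ => mul_nonneg (sq_nonneg _) (hv0 u).le
  have mono : ∀ {f g : ℝ → ℝ}, Continuous f → Continuous g → (∀ u ∈ Set.Icc 0 P, f u ≤ g u) →
      ∫ u in (0 : ℝ)..P, f u ≤ ∫ u in (0 : ℝ)..P, g u := fun hf hg h =>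
    intervalIntegral.integral_mono_on hP.le (hf.intervalIntegrable _ _)
      (hg.intervalIntegrable _ _) h
  generalize hLdef : (∫ u in (0 : ℝ)..P, v u) = L at *
  generalize hEdef : (∫ u in (0 : ℝ)..P, e u ^ 2 * v u) = E at *
  have hDE : (∫ u in (0 : ℝ)..P, d u ^ 2 * v u) ≤ L ^ 2 / 4 * E := by
    have : (∫ u in (0 : ℝ)..P, d u ^ 2 * v u) ≤ ∫ u in (0 : ℝ)..P, L / 4 * E * v u :=
      mono (by fun_prop) (by fun_prop) fun u hu =>
        mul_le_mul_of_nonneg_right (hsupd u hu) (hv0 u).le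
    rw [intervalIntegral.integral_const_mul, hLdef] at this
    linarith
  have hsupf : ∀ u ∈ Set.Icc 0 P, (k u - m) ^ 2 ≤ L ^ 3 / 16 * E := fun u hu => by
    have := mul_le_mul_of_nonneg_left hDE (by positivity : 0 ≤ L / 4)
    linarith [hsupf0 u hu]
  have hM2le : (∫ u in (0 : ℝ)..P, (k u - m) ^ 2 * d u ^ 2 * v u)
      ≤ L / 4 * E * (∫ u in (0 : ℝ)..P, (k u - m) ^ 2 * v u) := by
    rw [← intervalIntegral.integral_const_mul]
    refine mono (by fun_prop) (by fun_prop) fun u hu => ?_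
    have := mul_le_mul_of_nonneg_right (hsupd u hu)
      (mul_nonneg (sq_nonneg (k u - m)) (hv0 u).le)
    linarith
  have hquart : (∫ u in (0 : ℝ)..P, (k u - m) ^ 4 * v u)
      ≤ L ^ 3 / 16 * E * (∫ u in (0 : ℝ)..P, (k u - m) ^ 2 * v u) := by
    rw [← intervalIntegral.integral_const_mul]
    refine mono (by fun_prop) (by fun_prop) fun u hu => ?_
    have := mul_le_mul_of_nonneg_right (hsupf u hu)
      (mul_nonneg (sq_nonneg (k u - m)) (hv0 u).le)
    linarith
  generalize (∫ u in (0 : ℝ)..P, k u * v u) = I at *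
  -- The weights `π/4` and `36π` in the arithmetic-geometric mean inequality balance the two
  -- resulting terms when `K_osc = 1/9`.
  have hR : I * (-3 * ∫ u in (0 : ℝ)..P, (k u - m) ^ 2 * e u * v u) ≤
      Real.pi / 4 * L * E + 36 * Real.pi / L * ∫ u in (0 : ℝ)..P, (k u - m) ^ 4 * v u := by
    have h0 : 0 ≤ ∫ u in (0 : ℝ)..P, (Real.pi * L * e u + 6 * I * (k u - m) ^ 2) ^ 2 * v u :=
      intervalIntegral.integral_nonneg hP.le fun u _ => mul_nonneg (sq_nonneg _) (hv0 u).le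
    rw [integral_eq_of_eq_linear_combination (f := fun u => e u ^ 2 * v u)
        (g := fun u => (k u - m) ^ 2 * e u * v u) (h := fun u => (k u - m) ^ 4 * v u)
        ((Real.pi * L) ^ 2) (12 * Real.pi * L * I) (36 * I ^ 2)
        (by fun_prop) (by fun_prop) (by fun_prop) fun u => by ring, hEdef, hI] at h0
    have hpi := Real.pi_pos
    have h1 := div_nonneg h0 (by positivity : 0 ≤ 4 * Real.pi * L)
    have h2 : ((Real.pi * L) ^ 2 * E
        + 12 * Real.pi * L * I * (∫ u in (0 : ℝ)..P, (k u - m) ^ 2 * e u * v u)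
        + 36 * (4 * Real.pi ^ 2) * ∫ u in (0 : ℝ)..P, (k u - m) ^ 4 * v u) / (4 * Real.pi * L)
      = Real.pi / 4 * L * E + 3 * I * (∫ u in (0 : ℝ)..P, (k u - m) ^ 2 * e u * v u)
        + 36 * Real.pi / L * ∫ u in (0 : ℝ)..P, (k u - m) ^ 4 * v u := by
      field_simp
      ring
    linarith
  refine interpolation_algebra hL hD0 hE0 hN0 hmL hI hNJ (by rw [hNJ, hI]; exact hK) hM2le hM1R
    (hR.trans (add_le_add_right (mul_le_mul_of_nonneg_left hquart ?_) _))
  have := Real.pi_pos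
  positivity

/-! ### Wirtinger's inequality and the isoperimetric inequality -/

/-- Wirtinger's inequality for a closed `C¹` function of mean zero on `[0, L]`, from Parseval's
identity: the `n`-th Fourier coefficient of `f'` is `2πin / L` times that of `f`. -/
theorem wirtinger {L : ℝ} (hL : 0 < L) {f f' : ℝ → ℂ} (hf : ∀ x, HasDerivAt f (f' x) x)
    (hf' : Continuous f') (hfL : f L = f 0) (h0 : ∫ x in (0 : ℝ)..L, f x = 0) :
    ∫ x in (0 : ℝ)..L, ‖f x‖ ^ 2
      ≤ (L / (2 * Real.pi)) ^ 2 * ∫ x in (0 : ℝ)..L, ‖f' x‖ ^ 2 := by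
  have hfc : Continuous f := continuous_iff_continuousAt.2 fun u => (hf u).continuousAt
  have mem : ∀ {g : ℝ → ℂ}, Continuous g →
      MeasureTheory.MemLp g 2 (MeasureTheory.volume.restrict (Set.Ioc 0 L)) := fun {g} hg => by
    obtain ⟨C, hC⟩ := (isCompact_Icc (a := (0 : ℝ)) (b := L)).exists_bound_of_continuousOn
      hg.continuousOn
    refine MeasureTheory.MemLp.of_bound hg.aestronglyMeasurable C ?_
    rw [MeasureTheory.ae_restrict_iff' measurableSet_Ioc]
    exact Filter.Eventually.of_forall fun x hx => hC x (Set.Ioc_subset_Icc_self hx)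
  have s1 := hasSum_sq_fourierCoeffOn hL (mem hfc)
  have s2 := (hasSum_sq_fourierCoeffOn hL (mem hf')).mul_left ((L / (2 * Real.pi)) ^ 2)
  have key : ∀ n : ℤ, ‖fourierCoeffOn hL f n‖ ^ 2
      ≤ (L / (2 * Real.pi)) ^ 2 * ‖fourierCoeffOn hL f' n‖ ^ 2 := fun n => by
    rcases eq_or_ne n 0 with rfl | hn
    · have e0 : fourierCoeffOn hL f 0 = 0 := by
        rw [fourierCoeffOn_eq_integral]
        simp [h0]
      rw [e0, norm_zero, zero_pow two_ne_zero]
      positivity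
    · rw [fourierCoeffOn_of_hasDerivAt hL hn (fun x _ => hf x) (hf'.intervalIntegrable _ _), hfL,
        sub_self, mul_zero, zero_sub, norm_mul, norm_neg, norm_mul, mul_pow, mul_pow, ← mul_assoc]
      refine mul_le_mul_of_nonneg_right ?_ (sq_nonneg _)
      have hn1 : (1 : ℝ) ≤ |(n : ℝ)| := by exact_mod_cast Int.one_le_abs hn
      have hpi := Real.pi_pos
      simp only [sub_zero, Complex.ofReal_zero, norm_div, norm_mul, norm_neg, Complex.norm_I,
        Complex.norm_real, norm_one, Complex.norm_intCast, Real.norm_eq_abs, Complex.norm_ofNat,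
        abs_of_pos hL, abs_of_pos hpi, mul_one]
      rw [← mul_pow, div_mul_eq_mul_div, one_mul]
      refine pow_le_pow_left₀ (by positivity) ?_ 2
      refine div_le_div_of_nonneg_left hL.le (by positivity) ?_
      exact le_mul_of_one_le_right (by positivity) hn1
  have := hasSum_le key s1 s2
  simp only [sub_zero, smul_eq_mul] at this
  rw [mul_left_comm] at this
  exact le_of_mul_le_mul_left this (by positivity)

/-- Wirtinger's inequality for an arbitrary parametrisation of speed `v`, with `g = f_s`. -/
theorem wirtinger_of_speed {P : ℝ} (hP : 0 < P) {v : ℝ → ℝ} {f g : ℝ → ℂ} (hv : Continuous v)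
    (hvP : Function.Periodic v P) (hv0 : ∀ u, 0 < v u) (hg : Continuous g)
    (hf : ∀ u, HasDerivAt f (v u * g u) u) (hfP : f P = f 0)
    (h0 : ∫ u in (0 : ℝ)..P, v u • f u = 0) :
    ∫ u in (0 : ℝ)..P, v u * ‖f u‖ ^ 2
      ≤ ((∫ u in (0 : ℝ)..P, v u) / (2 * Real.pi)) ^ 2
        * ∫ u in (0 : ℝ)..P, v u * ‖g u‖ ^ 2 := by
  have hfc : Continuous f := continuous_iff_continuousAt.2 fun u => (hf u).continuousAt
  set s : ℝ → ℝ := fun u => ∫ w in (0 : ℝ)..u, v w with hs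
  have hsd : ∀ u, HasDerivAt s (v u) u := fun u =>
    intervalIntegral.integral_hasDerivAt_right (hv.intervalIntegrable _ _)
      (hv.stronglyMeasurableAtFilter _ _) hv.continuousAt
  have hsc : Continuous s := continuous_iff_continuousAt.2 fun u => (hsd u).continuousAt
  have hsm : StrictMono s := strictMono_of_deriv_pos fun u => by rw [(hsd u).deriv]; exact hv0 u
  have hint : ∀ a b, IntervalIntegrable v MeasureTheory.volume a b :=
    fun a b => hv.intervalIntegrable a b
  have hsurj : Function.Surjective s := hsc.surjective
    (hvP.tendsto_atTop_intervalIntegral_of_pos' (hint _ _) hv0 hP)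
    (hvP.tendsto_atBot_intervalIntegral_of_pos' (hint _ _) hv0 hP)
  set φ := (StrictMono.orderIsoOfSurjective s hsm hsurj).symm with hφ
  have hsφ : ∀ x, s (φ x) = x := fun x =>
    (StrictMono.orderIsoOfSurjective s hsm hsurj).apply_symm_apply x
  have hφs : ∀ u, φ (s u) = u := fun u =>
    (StrictMono.orderIsoOfSurjective s hsm hsurj).symm_apply_apply u
  have hφc : Continuous φ := φ.continuous
  have hφd : ∀ x, HasDerivAt φ (v (φ x))⁻¹ x := fun x =>
    HasDerivAt.of_local_left_inverse hφc.continuousAt (hsd _) (hv0 _).ne'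
      (Filter.Eventually.of_forall hsφ)
  have hs0 : s 0 = 0 := by simp [hs]
  have hL : 0 < s P := intervalIntegral.intervalIntegral_pos_of_pos (hint _ _) hv0 hP
  have cov : ∀ {E : Type} [NormedAddCommGroup E] [NormedSpace ℝ E] {G : ℝ → E}, Continuous G →
      ∫ x in (0 : ℝ)..s P, G (φ x) = ∫ u in (0 : ℝ)..P, v u • G u := fun {E} _ _ {G} hG => by
    have := intervalIntegral.integral_deriv_smul_comp (a := 0) (b := P) (f := s) (f' := v)
      (g := fun x => G (φ x)) (fun u _ => hsd u) hv.continuousOn (hG.comp hφc)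
    simp only [Function.comp_def, hφs, hs0] at this
    exact this.symm
  have := wirtinger hL (f := fun x => f (φ x)) (f' := fun x => g (φ x))
    (fun x => by
      have h1 := (hf (φ x)).scomp x (hφd x)
      refine h1.congr_deriv ?_
      rw [Complex.real_smul, ← mul_assoc, Complex.ofReal_inv, inv_mul_cancel₀, one_mul]
      exact_mod_cast (hv0 _).ne')
    (hg.comp hφc) (by rw [hφs, ← hs0, hφs, hfP]) (by rw [cov hfc, h0])
  rw [cov (G := fun u => ‖f u‖ ^ 2) (by fun_prop),
    cov (G := fun u => ‖g u‖ ^ 2) (by fun_prop)] at this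
  simpa only [smul_eq_mul] using this

/-- The isoperimetric inequality `4π |A| ≤ L²` for a closed plane curve `(x, y)` with speed `v`
and unit tangent `(a, b)`. -/
theorem isoperimetric {P : ℝ} (hP : 0 < P) {v x y a b : ℝ → ℝ} (hv : Continuous v)
    (hvP : Function.Periodic v P) (hv0 : ∀ u, 0 < v u) (ha : Continuous a) (hb : Continuous b)
    (hab : ∀ u, a u ^ 2 + b u ^ 2 = 1) (hx : ∀ u, HasDerivAt x (v u * a u) u)
    (hy : ∀ u, HasDerivAt y (v u * b u) u) (hxP : x P = x 0) (hyP : y P = y 0) :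
    2 * Real.pi * |∫ u in (0 : ℝ)..P, (x u * b u - y u * a u) * v u|
      ≤ (∫ u in (0 : ℝ)..P, v u) ^ 2 := by
  have hL : 0 < ∫ u in (0 : ℝ)..P, v u :=
    intervalIntegral.intervalIntegral_pos_of_pos (hv.intervalIntegrable _ _) hv0 hP
  have hxc : Continuous x := continuous_iff_continuousAt.2 fun u => (hx u).continuousAt
  have hyc : Continuous y := continuous_iff_continuousAt.2 fun u => (hy u).continuousAt
  generalize hLdef : (∫ u in (0 : ℝ)..P, v u) = L at *
  obtain ⟨p, hp⟩ : ∃ p, p = (∫ u in (0 : ℝ)..P, x u * v u) / L := ⟨_, rfl⟩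
  obtain ⟨q, hq⟩ : ∃ q, q = (∫ u in (0 : ℝ)..P, y u * v u) / L := ⟨_, rfl⟩
  have hpi := Real.pi_pos
  have mean : ∀ {z : ℝ → ℝ} {r : ℝ}, Continuous z → r = (∫ u in (0 : ℝ)..P, z u * v u) / L →
      ∫ u in (0 : ℝ)..P, v u * (z u - r) = 0 := fun {z r} hz hr => by
    rw [integral_eq_of_eq_linear_combination (f := fun u => z u * v u) (g := v) (h := v) 1 (-r) 0
      (by fun_prop) hv hv fun u => by ring, hLdef, hr]
    field_simp
    ring
  have hw := wirtinger_of_speed hP (f := fun u => ((x u - p : ℝ) : ℂ) + (y u - q : ℝ) * Complex.I)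
    (g := fun u => (a u : ℂ) + b u * Complex.I) hv hvP hv0 (by fun_prop)
    (fun u => by
      refine (((hx u).sub_const p).ofReal_comp.add
        (((hy u).sub_const q).ofReal_comp.mul_const Complex.I)).congr_deriv ?_
      push_cast; ring)
    (by simp only [hxP, hyP])
    (by
      have : ∀ u, v u • (((x u - p : ℝ) : ℂ) + (y u - q : ℝ) * Complex.I)
          = ((v u * (x u - p) : ℝ) : ℂ) + ((v u * (y u - q) : ℝ) : ℂ) * Complex.I := fun u => by
        rw [Complex.real_smul]; push_cast; ring
      simp only [this]
      rw [intervalIntegral.integral_add (Continuous.intervalIntegrable (by fun_prop) _ _)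
        (Continuous.intervalIntegrable (by fun_prop) _ _), intervalIntegral.integral_mul_const,
        intervalIntegral.integral_ofReal, intervalIntegral.integral_ofReal, mean hxc hp,
        mean hyc hq]
      simp)
  simp only [← Complex.normSq_eq_norm_sq, Complex.normSq_add_mul_I, hab, mul_one] at hw
  rw [hLdef] at hw
  -- The area does not change under the translation by `(p, q)`.
  have htr : ∫ u in (0 : ℝ)..P, (x u * b u - y u * a u) * v u
      = ∫ u in (0 : ℝ)..P, ((x u - p) * b u - (y u - q) * a u) * v u := by
    have e1 := integral_eq_zero_of_hasDerivAt_of_eq hx (hv.mul ha) hxP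
    have e2 := integral_eq_zero_of_hasDerivAt_of_eq hy (hv.mul hb) hyP
    rw [integral_eq_of_eq_linear_combination
      (F := fun u => ((x u - p) * b u - (y u - q) * a u) * v u)
      (f := fun u => (x u * b u - y u * a u) * v u) (g := fun u => v u * a u)
      (h := fun u => v u * b u) 1 q (-p)
      (by fun_prop) (by fun_prop) (by fun_prop) fun u => by ring, e1, e2]
    ring
  rw [htr]
  -- Pointwise, `|z × z'| ≤ (π / L) |z|² + L / 4π` for the unit vector `z'`.
  have habs : |∫ u in (0 : ℝ)..P, ((x u - p) * b u - (y u - q) * a u) * v u|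
      ≤ ∫ u in (0 : ℝ)..P, (Real.pi / L * (v u * ((x u - p) ^ 2 + (y u - q) ^ 2))
        + L / (4 * Real.pi) * v u + 0 * v u) := by
    refine (intervalIntegral.abs_integral_le_integral_abs hP.le).trans ?_
    refine intervalIntegral.integral_mono_on hP.le
      (Continuous.intervalIntegrable (by fun_prop) _ _)
      (Continuous.intervalIntegrable (by fun_prop) _ _) fun u _ => ?_
    rw [abs_mul, abs_of_pos (hv0 u)]
    have h1 : |(x u - p) * b u - (y u - q) * a u|
        ≤ Real.pi / L * ((x u - p) ^ 2 + (y u - q) ^ 2) + L / (4 * Real.pi) := by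
      have hcs : ((x u - p) * b u - (y u - q) * a u) ^ 2 ≤ (x u - p) ^ 2 + (y u - q) ^ 2 := by
        have : (x u - p) ^ 2 + (y u - q) ^ 2 = ((x u - p) * b u - (y u - q) * a u) ^ 2
            + ((x u - p) * a u + (y u - q) * b u) ^ 2 := by
          linear_combination (-((x u - p) ^ 2 + (y u - q) ^ 2)) * hab u
        rw [this]; linarith [sq_nonneg ((x u - p) * a u + (y u - q) * b u)]
      refine le_trans ?_ (add_le_add_left (mul_le_mul_of_nonneg_left hcs (by positivity)) _)
      rw [← sq_abs]
      generalize |(x u - p) * b u - (y u - q) * a u| = r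
      have : Real.pi / L * r ^ 2 + L / (4 * Real.pi) - r
          = (2 * Real.pi * r - L) ^ 2 / (4 * Real.pi * L) := by
        field_simp; ring
      have : 0 ≤ (2 * Real.pi * r - L) ^ 2 / (4 * Real.pi * L) := by positivity
      linarith
    have := mul_le_mul_of_nonneg_right h1 (hv0 u).le
    linarith
  rw [integral_eq_of_eq_linear_combination _ _ _ (by fun_prop) hv hv fun u => rfl, hLdef] at habs
  have h3 := mul_le_mul_of_nonneg_left hw (by positivity : 0 ≤ Real.pi / L)
  have h4 : Real.pi / L * ((L / (2 * Real.pi)) ^ 2 * L) = L ^ 2 / (4 * Real.pi) := by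
    field_simp; ring
  have h5 : L / (4 * Real.pi) * L = L ^ 2 / (4 * Real.pi) := by ring
  rw [h4] at h3
  calc _ ≤ 2 * Real.pi * (L ^ 2 / (4 * Real.pi) + L ^ 2 / (4 * Real.pi)) :=
        mul_le_mul_of_nonneg_left (by linarith) (by positivity)
    _ = L ^ 2 := by field_simp; ring

/-! ### Loops and self-intersections -/

section Loop

variable {v x y a b κ : ℝ → ℝ}

/-- The cosine of the angle between the unit tangent `(a, b)` and the ray from the point `(p, q)`
to the curve `(x, y)`. -/
noncomputable def radialCos (x y a b : ℝ → ℝ) (p q s : ℝ) : ℝ :=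
  ((x s - p) * a s + (y s - q) * b s) / Real.sqrt ((x s - p) ^ 2 + (y s - q) ^ 2)

theorem chord_le_integral_speed (hv : Continuous v) (hv0 : ∀ u, 0 < v u) (ha : Continuous a)
    (hb : Continuous b) (hab : ∀ u, a u ^ 2 + b u ^ 2 = 1)
    (hx : ∀ u, HasDerivAt x (v u * a u) u) (hy : ∀ u, HasDerivAt y (v u * b u) u)
    {s t : ℝ} (hst : s ≤ t) :
    Real.sqrt ((x t - x s) ^ 2 + (y t - y s) ^ 2) ≤ ∫ u in s..t, v u := by
  have h1 : ((x t - x s : ℝ) : ℂ) + (y t - y s : ℝ) * Complex.I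
      = ∫ u in s..t, ((v u * a u : ℝ) : ℂ) + (v u * b u : ℝ) * Complex.I := by
    rw [intervalIntegral.integral_eq_sub_of_hasDerivAt
      (f := fun u => (x u : ℂ) + y u * Complex.I)
      (fun u _ => (hx u).ofReal_comp.add ((hy u).ofReal_comp.mul_const _))
      (Continuous.intervalIntegrable (by fun_prop) _ _)]
    push_cast; ring
  rw [← Complex.norm_add_mul_I, h1]
  refine (intervalIntegral.norm_integral_le_integral_norm hst).trans_eq ?_
  congr 1
  ext u
  rw [Complex.norm_add_mul_I, show (v u * a u) ^ 2 + (v u * b u) ^ 2 = v u ^ 2 by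
    linear_combination v u ^ 2 * hab u, Real.sqrt_sq (hv0 u).le]

/-- The cosine of the angle between chord direction and tangent tends to `1` at the base point; with
slopes in place of chords the limit is two-sided. -/
theorem tendsto_slope_cos (hv0 : ∀ u, 0 < v u) (ha : Continuous a)
    (hb : Continuous b) (hab : ∀ u, a u ^ 2 + b u ^ 2 = 1)
    (hx : ∀ u, HasDerivAt x (v u * a u) u) (hy : ∀ u, HasDerivAt y (v u * b u) u) (c : ℝ) :
    Filter.Tendsto (fun s => (slope x c s * a s + slope y c s * b s)
      / Real.sqrt (slope x c s ^ 2 + slope y c s ^ 2)) (nhdsWithin c {c}ᶜ) (nhds 1) := by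
  have h1 := hasDerivAt_iff_tendsto_slope.1 (hx c)
  have h2 := hasDerivAt_iff_tendsto_slope.1 (hy c)
  have h3 : Filter.Tendsto a (nhdsWithin c {c}ᶜ) (nhds (a c)) :=
    ha.continuousAt.tendsto.mono_left nhdsWithin_le_nhds
  have h4 : Filter.Tendsto b (nhdsWithin c {c}ᶜ) (nhds (b c)) :=
    hb.continuousAt.tendsto.mono_left nhdsWithin_le_nhds
  have e : Real.sqrt ((v c * a c) ^ 2 + (v c * b c) ^ 2) = v c := by
    rw [show (v c * a c) ^ 2 + (v c * b c) ^ 2 = v c ^ 2 by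
      linear_combination v c ^ 2 * hab c, Real.sqrt_sq (hv0 c).le]
  have := ((h1.mul h3).add (h2.mul h4)).div (((h1.pow 2).add (h2.pow 2)).sqrt)
    (by rw [e]; exact (hv0 c).ne')
  rw [e] at this
  convert! this using 2
  rw [eq_div_iff (hv0 c).ne']
  linear_combination (-v c) * hab c

theorem radialCos_eq_slope (c s : ℝ) :
    radialCos x y a b (x c) (y c) s = ((s - c) / |s - c|) *
      ((slope x c s * a s + slope y c s * b s)
        / Real.sqrt (slope x c s ^ 2 + slope y c s ^ 2)) := by
  rcases eq_or_ne s c with rfl | hs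
  · simp [radialCos]
  have hs' : s - c ≠ 0 := sub_ne_zero.2 hs
  have ex : x s - x c = (s - c) * slope x c s := by rw [slope_def_field]; field_simp
  have ey : y s - y c = (s - c) * slope y c s := by rw [slope_def_field]; field_simp
  rw [radialCos, ex, ey, show ((s - c) * slope x c s) ^ 2 + ((s - c) * slope y c s) ^ 2
    = (s - c) ^ 2 * (slope x c s ^ 2 + slope y c s ^ 2) by ring,
    Real.sqrt_mul (sq_nonneg _), Real.sqrt_sq_eq_abs, div_mul_div_comm]
  congr 1
  ring

theorem tendsto_radialCos_right (hv0 : ∀ u, 0 < v u) (ha : Continuous a)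
    (hb : Continuous b) (hab : ∀ u, a u ^ 2 + b u ^ 2 = 1)
    (hx : ∀ u, HasDerivAt x (v u * a u) u) (hy : ∀ u, HasDerivAt y (v u * b u) u) (c : ℝ) :
    Filter.Tendsto (radialCos x y a b (x c) (y c)) (nhdsWithin c (Set.Ioi c)) (nhds 1) := by
  refine ((tendsto_slope_cos hv0 ha hb hab hx hy c).mono_left
    (nhdsWithin_mono _ fun s hs => (ne_of_gt hs))).congr' ?_
  filter_upwards [self_mem_nhdsWithin] with s hs
  have : 0 < s - c := sub_pos.2 hs
  rw [radialCos_eq_slope, abs_of_pos this, div_self this.ne', one_mul]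

theorem tendsto_radialCos_left (hv0 : ∀ u, 0 < v u) (ha : Continuous a)
    (hb : Continuous b) (hab : ∀ u, a u ^ 2 + b u ^ 2 = 1)
    (hx : ∀ u, HasDerivAt x (v u * a u) u) (hy : ∀ u, HasDerivAt y (v u * b u) u) (c : ℝ) :
    Filter.Tendsto (radialCos x y a b (x c) (y c)) (nhdsWithin c (Set.Iio c)) (nhds (-1)) := by
  refine (((tendsto_slope_cos hv0 ha hb hab hx hy c).mono_left
    (nhdsWithin_mono _ fun s hs => (ne_of_lt hs))).neg).congr' ?_
  filter_upwards [self_mem_nhdsWithin] with s hs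
  have : s - c < 0 := sub_neg.2 hs
  rw [radialCos_eq_slope, abs_of_neg this, div_neg, div_self this.ne, neg_one_mul]

/-- Away from the point `(p, q)`, the derivative of the cosine of the radial angle is
`v sin² / r + κ sin`, which is at least `-r k² v / 4` by completing the square. -/
theorem exists_hasDerivAt_radialCos (hv0 : ∀ u, 0 < v u)
    (hab : ∀ u, a u ^ 2 + b u ^ 2 = 1)
    (hx : ∀ u, HasDerivAt x (v u * a u) u) (hy : ∀ u, HasDerivAt y (v u * b u) u)
    (ha : ∀ u, HasDerivAt a (-κ u * b u) u) (hb : ∀ u, HasDerivAt b (κ u * a u) u)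
    {p q s : ℝ} (hne : 0 < (x s - p) ^ 2 + (y s - q) ^ 2) :
    ∃ D, HasDerivAt (radialCos x y a b p q) D s ∧
      -(Real.sqrt ((x s - p) ^ 2 + (y s - q) ^ 2) / 4 * (κ s ^ 2 / v s)) ≤ D := by
  have hr := Real.sqrt_pos.2 hne
  have hr2 := Real.sq_sqrt hne.le
  have hX := (hx s).sub_const p
  have hY := (hy s).sub_const q
  have hnum := (hX.mul (ha s)).add (hY.mul (hb s))
  have hden := ((hX.fun_pow 2).add (hY.fun_pow 2)).sqrt hne.ne'
  refine ⟨_, hnum.div hden hr.ne', ?_⟩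
  simp only [Pi.add_apply, Pi.mul_apply]
  have hvs := hv0 s
  have h1 := hab s
  generalize Real.sqrt ((x s - p) ^ 2 + (y s - q) ^ 2) = r at *
  generalize x s - p = X at *
  generalize y s - q = Y at *
  generalize v s = w at *
  generalize a s = α at *
  generalize b s = β at *
  generalize κ s = k at *
  rw [← sub_nonneg]
  have hB : r ^ 2 = (X * α + Y * β) ^ 2 + (Y * α - X * β) ^ 2 := by
    rw [hr2]; linear_combination (-(X ^ 2 + Y ^ 2)) * h1
  have : 0 ≤ (2 * w * (Y * α - X * β) + k * r ^ 2) ^ 2 / (4 * w * r ^ 3) := by positivity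
  refine this.trans_eq ?_
  push_cast
  field_simp
  linear_combination (-4 * w ^ 2) * hB - (4 * r ^ 2 * w ^ 2) * h1

/-- A loop with first return at its end has `ℓ ∫ k² ds ≥ 16`: the cosine of the radial angle goes
from `1` to `-1`, and the distance to the base point is at most `ℓ / 2`. -/
theorem sixteen_le_of_simple_loop (hv : Continuous v) (hv0 : ∀ u, 0 < v u) (hκ : Continuous κ)
    (hab : ∀ u, a u ^ 2 + b u ^ 2 = 1)
    (hx : ∀ u, HasDerivAt x (v u * a u) u) (hy : ∀ u, HasDerivAt y (v u * b u) u)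
    (ha : ∀ u, HasDerivAt a (-κ u * b u) u) (hb : ∀ u, HasDerivAt b (κ u * a u) u)
    {c d : ℝ} (hcd : c < d) (hxc : x d = x c) (hyc : y d = y c)
    (hne : ∀ s ∈ Set.Ioo c d, ¬(x s = x c ∧ y s = y c)) :
    16 ≤ (∫ u in c..d, v u) * ∫ u in c..d, κ u ^ 2 / v u := by
  have hac : Continuous a := continuous_iff_continuousAt.2 fun u => (ha u).continuousAt
  have hbc : Continuous b := continuous_iff_continuousAt.2 fun u => (hb u).continuousAt
  have hkc : Continuous fun u => κ u ^ 2 / v u :=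
    (hκ.pow 2).div hv fun u => (hv0 u).ne'
  set ℓ := ∫ u in c..d, v u with hℓ
  set J : ℝ → ℝ := fun s => ∫ u in c..s, κ u ^ 2 / v u with hJ
  have hJd : ∀ s, HasDerivAt J (κ s ^ 2 / v s) s := fun s =>
    intervalIntegral.integral_hasDerivAt_right (hkc.intervalIntegrable _ _)
      (hkc.stronglyMeasurableAtFilter _ _) hkc.continuousAt
  have hJc : Continuous J := continuous_iff_continuousAt.2 fun u => (hJd u).continuousAt
  set H : ℝ → ℝ := fun s => radialCos x y a b (x c) (y c) s + ℓ / 8 * J s with hH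
  have hder : ∀ s ∈ Set.Ioo c d, ∃ D, HasDerivAt H D s ∧ 0 ≤ D := fun s hs => by
    have hpos : 0 < (x s - x c) ^ 2 + (y s - y c) ^ 2 := by
      by_contra hcon
      have h1 : (x s - x c) ^ 2 = 0 := by nlinarith [sq_nonneg (x s - x c), sq_nonneg (y s - y c)]
      have h2 : (y s - y c) ^ 2 = 0 := by nlinarith [sq_nonneg (x s - x c), sq_nonneg (y s - y c)]
      exact hne s hs ⟨sub_eq_zero.1 (pow_eq_zero_iff two_ne_zero |>.1 h1),
        sub_eq_zero.1 (pow_eq_zero_iff two_ne_zero |>.1 h2)⟩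
    obtain ⟨D, hD, hle⟩ := exists_hasDerivAt_radialCos hv0 hab hx hy ha hb hpos
    refine ⟨_, hD.add ((hJd s).const_mul (ℓ / 8)), ?_⟩
    have r1 := chord_le_integral_speed hv hv0 hac hbc hab hx hy hs.1.le
    have r2 := chord_le_integral_speed hv hv0 hac hbc hab hx hy hs.2.le
    rw [hxc, hyc, ← neg_sub (x s), ← neg_sub (y s), neg_sq, neg_sq] at r2
    have r3 := intervalIntegral.integral_add_adjacent_intervals
      (hv.intervalIntegrable (μ := MeasureTheory.volume) c s) (hv.intervalIntegrable s d)
    have hk0 : 0 ≤ κ s ^ 2 / v s := div_nonneg (sq_nonneg _) (hv0 s).le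
    have : Real.sqrt ((x s - x c) ^ 2 + (y s - y c) ^ 2) / 4 * (κ s ^ 2 / v s)
        ≤ ℓ / 8 * (κ s ^ 2 / v s) := mul_le_mul_of_nonneg_right (by linarith) hk0
    linarith
  have hmono : MonotoneOn H (Set.Ioo c d) := by
    refine monotoneOn_of_deriv_nonneg (convex_Ioo c d) (fun s hs => ?_) (fun s hs => ?_)
      fun s hs => ?_
    · obtain ⟨D, hD, -⟩ := hder s hs
      exact hD.continuousAt.continuousWithinAt
    · rw [interior_Ioo] at hs
      obtain ⟨D, hD, -⟩ := hder s hs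
      exact hD.differentiableAt.differentiableWithinAt
    · rw [interior_Ioo] at hs
      obtain ⟨D, hD, hD0⟩ := hder s hs
      rwa [hD.deriv]
  have l1 : Filter.Tendsto H (nhdsWithin c (Set.Ioi c)) (nhds (1 + ℓ / 8 * J c)) :=
    (tendsto_radialCos_right hv0 hac hbc hab hx hy c).add
      ((hJc.continuousAt.tendsto.mono_left nhdsWithin_le_nhds).const_mul _)
  have l2 : Filter.Tendsto H (nhdsWithin d (Set.Iio d)) (nhds (-1 + ℓ / 8 * J d)) := by
    have := tendsto_radialCos_left hv0 hac hbc hab hx hy d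
    rw [hxc, hyc] at this
    exact this.add ((hJc.continuousAt.tendsto.mono_left nhdsWithin_le_nhds).const_mul _)
  have hle : 1 + ℓ / 8 * J c ≤ -1 + ℓ / 8 * J d := by
    refine le_of_tendsto l1 ?_
    filter_upwards [Ioo_mem_nhdsGT hcd] with s hs
    refine ge_of_tendsto l2 ?_
    filter_upwards [Ioo_mem_nhdsLT hs.2] with t ht
    exact hmono hs ⟨hs.1.trans ht.1, ht.2⟩ ht.1.le
  have hJ0 : J c = 0 := intervalIntegral.integral_same
  rw [hJ0] at hle
  linarith

/-- A loop has `ℓ ∫ k² ds ≥ 16`: it contains a sub-loop ending at its first return. -/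
theorem sixteen_le_of_loop (hv : Continuous v) (hv0 : ∀ u, 0 < v u) (hκ : Continuous κ)
    (hab : ∀ u, a u ^ 2 + b u ^ 2 = 1)
    (hx : ∀ u, HasDerivAt x (v u * a u) u) (hy : ∀ u, HasDerivAt y (v u * b u) u)
    (ha : ∀ u, HasDerivAt a (-κ u * b u) u) (hb : ∀ u, HasDerivAt b (κ u * a u) u)
    {c d : ℝ} (hcd : c < d) (hxc : x d = x c) (hyc : y d = y c) :
    16 ≤ (∫ u in c..d, v u) * ∫ u in c..d, κ u ^ 2 / v u := by
  have hxcont : Continuous x := continuous_iff_continuousAt.2 fun u => (hx u).continuousAt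
  have hycont : Continuous y := continuous_iff_continuousAt.2 fun u => (hy u).continuousAt
  have hkc : Continuous fun u => κ u ^ 2 / v u :=
    (hκ.pow 2).div hv fun u => (hv0 u).ne'
  -- Returns to the base point do not accumulate at `c`, so there is a first one, `d'`.
  have hev : ∀ᶠ s in nhdsWithin c (Set.Ioi c), ¬(x s = x c ∧ y s = y c) := by
    have hsub : nhdsWithin c (Set.Ioi c) ≤ nhdsWithin c {c}ᶜ :=
      nhdsWithin_mono _ fun s hs => ne_of_gt hs
    have : a c ≠ 0 ∨ b c ≠ 0 := by
      by_contra! h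
      have := hab c
      rw [h.1, h.2] at this
      norm_num at this
    rcases this with h | h
    · filter_upwards [hsub ((hx c).eventually_ne (c := x c) (mul_ne_zero (hv0 c).ne' h))] with s hs
      exact fun h' => hs h'.1
    · filter_upwards [hsub ((hy c).eventually_ne (c := y c) (mul_ne_zero (hv0 c).ne' h))] with s hs
      exact fun h' => hs h'.2
  obtain ⟨m, hm, hmsub⟩ := (mem_nhdsGT_iff_exists_Ioo_subset' hcd).1 hev
  have hcomp : IsCompact (Set.Icc m d ∩ {s | x s = x c ∧ y s = y c}) :=
    isCompact_Icc.inter_right ((isClosed_eq hxcont continuous_const).inter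
      (isClosed_eq hycont continuous_const))
  have hmd : m ≤ d := by
    by_contra! h
    exact hmsub ⟨hcd, h⟩ ⟨hxc, hyc⟩
  obtain ⟨d', ⟨⟨hd1, hd2⟩, hd3⟩, hleast⟩ := hcomp.exists_isLeast ⟨d, ⟨hmd, le_rfl⟩, hxc, hyc⟩
  have hcd' : c < d' := lt_of_lt_of_le hm hd1
  have key := sixteen_le_of_simple_loop hv hv0 hκ hab hx hy ha hb hcd' hd3.1 hd3.2
    fun s hs hs' => by
      by_cases h : s < m
      · exact hmsub ⟨hs.1, h⟩ hs'
      · exact absurd (hleast ⟨⟨not_lt.1 h, hs.2.le.trans hd2⟩, hs'⟩) (not_le.2 hs.2)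
  have mono : ∀ {f : ℝ → ℝ}, Continuous f → (∀ u, 0 ≤ f u) →
      ∫ u in c..d', f u ≤ ∫ u in c..d, f u := fun {f} hf h0 => by
    rw [← intervalIntegral.integral_add_adjacent_intervals (hf.intervalIntegrable c d')
      (hf.intervalIntegrable d' d)]
    linarith [intervalIntegral.integral_nonneg (μ := MeasureTheory.volume) hd2 fun u _ => h0 u]
  refine key.trans (mul_le_mul (mono hv fun u => (hv0 u).le)
    (mono hkc fun u => div_nonneg (sq_nonneg _) (hv0 u).le) ?_ ?_)
  · exact intervalIntegral.integral_nonneg hcd'.le fun u _ => div_nonneg (sq_nonneg _) (hv0 u).le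
  · exact intervalIntegral.integral_nonneg hcd.le fun u _ => (hv0 u).le

/-- A closed curve with a self-intersection consists of two loops, so `L ∫ k² ds ≥ (4 + 4)²`. -/
theorem sixty_four_le_of_self_intersection (hv : Continuous v) (hv0 : ∀ u, 0 < v u)
    (hκ : Continuous κ) (hab : ∀ u, a u ^ 2 + b u ^ 2 = 1)
    (hx : ∀ u, HasDerivAt x (v u * a u) u) (hy : ∀ u, HasDerivAt y (v u * b u) u)
    (ha : ∀ u, HasDerivAt a (-κ u * b u) u) (hb : ∀ u, HasDerivAt b (κ u * a u) u)
    {P : ℝ} (hxP : Function.Periodic x P) (hyP : Function.Periodic y P)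
    (hvP : Function.Periodic v P) (hκP : Function.Periodic κ P)
    {c d : ℝ} (hcd : c < d) (hdP : d < c + P) (hxc : x d = x c) (hyc : y d = y c) :
    64 ≤ (∫ u in (0 : ℝ)..P, v u) * ∫ u in (0 : ℝ)..P, κ u ^ 2 / v u := by
  have hkc : Continuous fun u => κ u ^ 2 / v u :=
    (hκ.pow 2).div hv fun u => (hv0 u).ne'
  have h1 := sixteen_le_of_loop hv hv0 hκ hab hx hy ha hb hcd hxc hyc
  have h2 := sixteen_le_of_loop hv hv0 hκ hab hx hy ha hb hdP
    (by rw [hxP, hxc]) (by rw [hyP, hyc])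
  have split : ∀ {f : ℝ → ℝ}, Continuous f → Function.Periodic f P →
      ∫ u in (0 : ℝ)..P, f u = (∫ u in c..d, f u) + ∫ u in d..(c + P), f u := fun {f} hf hP => by
    rw [intervalIntegral.integral_add_adjacent_intervals (hf.intervalIntegrable _ _)
      (hf.intervalIntegrable _ _)]
    simpa using hP.intervalIntegral_add_eq 0 c
  rw [split hv hvP, split hkc fun u => by simp only [hκP u, hvP u]]
  have n1 : 0 < ∫ u in c..d, v u :=
    intervalIntegral.intervalIntegral_pos_of_pos (hv.intervalIntegrable _ _) hv0 hcd
  have n2 : 0 < ∫ u in d..(c + P), v u :=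
    intervalIntegral.intervalIntegral_pos_of_pos (hv.intervalIntegrable _ _) hv0 hdP
  generalize (∫ u in c..d, v u) = l1 at *
  generalize (∫ u in d..(c + P), v u) = l2 at *
  generalize (∫ u in c..d, κ u ^ 2 / v u) = e1 at *
  generalize (∫ u in d..(c + P), κ u ^ 2 / v u) = e2 at *
  have f1 : 16 / l1 ≤ e1 := by rw [div_le_iff₀ n1]; linarith
  have f2 : 16 / l2 ≤ e2 := by rw [div_le_iff₀ n2]; linarith
  have f3 : (l1 + l2) * (16 / l1 + 16 / l2) ≤ (l1 + l2) * (e1 + e2) :=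
    mul_le_mul_of_nonneg_left (by linarith) (by positivity)
  refine le_trans ?_ f3
  have : (l1 + l2) * (16 / l1 + 16 / l2) - 64 = 16 * (l1 - l2) ^ 2 / (l1 * l2) := by
    field_simp; ring
  have : 0 ≤ 16 * (l1 - l2) ^ 2 / (l1 * l2) := by positivity
  linarith

end Loop

/-! ### Partial derivatives and differentiation under the integral sign -/

/-- The partial derivative `f_t` of a function of `(t, u)`. -/
noncomputable def dt (f : ℝ × ℝ → ℝ) (p : ℝ × ℝ) : ℝ := fderiv ℝ f p (1, 0)

/-- The partial derivative `f_u` of a function of `(t, u)`. -/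
noncomputable def du (f : ℝ × ℝ → ℝ) (p : ℝ × ℝ) : ℝ := fderiv ℝ f p (0, 1)

section Partial

variable {U : Set (ℝ × ℝ)} {f g : ℝ × ℝ → ℝ} {p : ℝ × ℝ}

theorem contDiffOn_dt (hU : IsOpen U) (hf : ContDiffOn ℝ ∞ f U) :
    ContDiffOn ℝ ∞ (dt f) U :=
  (hf.fderiv_of_isOpen hU (m := ∞) (by simp)).clm_apply contDiffOn_const

theorem contDiffOn_du (hU : IsOpen U) (hf : ContDiffOn ℝ ∞ f U) :
    ContDiffOn ℝ ∞ (du f) U :=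
  (hf.fderiv_of_isOpen hU (m := ∞) (by simp)).clm_apply contDiffOn_const

theorem differentiableAt_of_contDiffOn (hU : IsOpen U) (hf : ContDiffOn ℝ ∞ f U)
    (hp : p ∈ U) : DifferentiableAt ℝ f p :=
  (hf.contDiffAt (hU.mem_nhds hp)).differentiableAt (by simp)

theorem hasDerivAt_dt (h : DifferentiableAt ℝ f p) :
    HasDerivAt (fun r => f (r, p.2)) (dt f p) p.1 := by
  have h1 : HasDerivAt (fun r : ℝ => (r, p.2)) ((1 : ℝ), (0 : ℝ)) p.1 :=
    (hasDerivAt_id _).prodMk (hasDerivAt_const _ _)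
  exact HasFDerivAt.comp_hasDerivAt (f := fun r : ℝ => (r, p.2)) p.1 h.hasFDerivAt h1

theorem hasDerivAt_du (h : DifferentiableAt ℝ f p) :
    HasDerivAt (fun w => f (p.1, w)) (du f p) p.2 := by
  have h1 : HasDerivAt (fun w : ℝ => (p.1, w)) ((0 : ℝ), (1 : ℝ)) p.2 :=
    (hasDerivAt_const _ _).prodMk (hasDerivAt_id _)
  exact HasFDerivAt.comp_hasDerivAt (f := fun w : ℝ => (p.1, w)) p.2 h.hasFDerivAt h1

theorem dt_mul (hf : DifferentiableAt ℝ f p) (hg : DifferentiableAt ℝ g p) :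
    dt (fun q => f q * g q) p = f p * dt g p + g p * dt f p := by
  simp [dt, fderiv_fun_mul hf hg]

theorem du_mul (hf : DifferentiableAt ℝ f p) (hg : DifferentiableAt ℝ g p) :
    du (fun q => f q * g q) p = f p * du g p + g p * du f p := by
  simp [du, fderiv_fun_mul hf hg]

theorem dt_add (hf : DifferentiableAt ℝ f p) (hg : DifferentiableAt ℝ g p) :
    dt (fun q => f q + g q) p = dt f p + dt g p := by
  simp [dt, fderiv_fun_add hf hg]

theorem du_add (hf : DifferentiableAt ℝ f p) (hg : DifferentiableAt ℝ g p) :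
    du (fun q => f q + g q) p = du f p + du g p := by
  simp [du, fderiv_fun_add hf hg]

theorem dt_sub (hf : DifferentiableAt ℝ f p) (hg : DifferentiableAt ℝ g p) :
    dt (fun q => f q - g q) p = dt f p - dt g p := by
  simp [dt, fderiv_fun_sub hf hg]

theorem du_sub (hf : DifferentiableAt ℝ f p) (hg : DifferentiableAt ℝ g p) :
    du (fun q => f q - g q) p = du f p - du g p := by
  simp [du, fderiv_fun_sub hf hg]

theorem dt_congr (hU : IsOpen U) (h : Set.EqOn f g U) (hp : p ∈ U) : dt f p = dt g p := by
  rw [dt, dt, (h.eventuallyEq_of_mem (hU.mem_nhds hp)).fderiv_eq]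

theorem du_congr (hU : IsOpen U) (h : Set.EqOn f g U) (hp : p ∈ U) : du f p = du g p := by
  rw [du, du, (h.eventuallyEq_of_mem (hU.mem_nhds hp)).fderiv_eq]

theorem dt_const (c : ℝ) (p : ℝ × ℝ) : dt (fun _ => c) p = 0 := by simp [dt]

theorem du_const (c : ℝ) (p : ℝ × ℝ) : du (fun _ => c) p = 0 := by simp [du]

theorem dt_du_comm (hU : IsOpen U) (hf : ContDiffOn ℝ ∞ f U) (hp : p ∈ U) :
    dt (du f) p = du (dt f) p := by
  have hfp := hf.contDiffAt (hU.mem_nhds hp)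
  have hd : DifferentiableAt ℝ (fderiv ℝ f) p :=
    (hfp.fderiv_right (m := 1) (by norm_cast)).differentiableAt (by simp)
  have hsymm := hfp.isSymmSndFDerivAt (by simp; norm_cast)
  have e1 : dt (du f) p = fderiv ℝ (fderiv ℝ f) p (1, 0) (0, 1) := by
    unfold dt du
    rw [fderiv_clm_apply hd (differentiableAt_const _)]
    simp
  have e2 : du (dt f) p = fderiv ℝ (fderiv ℝ f) p (0, 1) (1, 0) := by
    unfold dt du
    rw [fderiv_clm_apply hd (differentiableAt_const _)]
    simp
  rw [e1, e2, hsymm]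

end Partial

/-- Differentiation under the integral sign, up to a total derivative: if `f_t = h + W_u` with `W`
periodic, then `d/dt ∫ f du = ∫ h du`. -/
theorem hasDerivAt_integral_of_dt_eq {S : Set ℝ} (hS : IsOpen S) {P : ℝ} {f h W : ℝ × ℝ → ℝ}
    (hf : ContDiffOn ℝ ∞ f (S ×ˢ Set.univ)) (hW : ContDiffOn ℝ ∞ W (S ×ˢ Set.univ))
    (hWP : ∀ t ∈ S, W (t, P) = W (t, 0))
    (heq : ∀ p ∈ S ×ˢ (Set.univ : Set ℝ), dt f p = h p + du W p) {t : ℝ} (ht : t ∈ S) :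
    HasDerivAt (fun r => ∫ u in (0 : ℝ)..P, f (r, u)) (∫ u in (0 : ℝ)..P, h (t, u)) t := by
  have hU : IsOpen (S ×ˢ (Set.univ : Set ℝ)) := hS.prod isOpen_univ
  have slice : ∀ {g : ℝ × ℝ → ℝ}, ContDiffOn ℝ ∞ g (S ×ˢ Set.univ) → ∀ r ∈ S,
      Continuous fun u => g (r, u) := fun {g} hg r hr => by
    rw [← continuousOn_univ]
    exact hg.continuousOn.comp (by fun_prop) fun u _ => ⟨hr, trivial⟩
  have hft := contDiffOn_dt hU hf
  have hWu := contDiffOn_du hU hW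
  obtain ⟨δ, hδ, hball⟩ := Metric.nhds_basis_closedBall.mem_iff.1 (hS.mem_nhds ht)
  obtain ⟨C, hC⟩ := ((isCompact_closedBall t δ).prod (isCompact_uIcc (a := 0) (b := P))
    |>.image_of_continuousOn (hft.continuousOn.mono
      (Set.prod_mono hball (Set.subset_univ _)))).isBounded.exists_norm_le
  have key := (intervalIntegral.hasDerivAt_integral_of_dominated_loc_of_deriv_le
    (F := fun r u => f (r, u)) (F' := fun r u => dt f (r, u)) (x₀ := t) (a := 0) (b := P)
    (μ := MeasureTheory.volume) (bound := fun _ => C)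
    (Metric.closedBall_mem_nhds t hδ)
    (by
      filter_upwards [Metric.closedBall_mem_nhds t hδ] with r hr
      exact (slice hf r (hball hr)).aestronglyMeasurable)
    ((slice hf t ht).intervalIntegrable _ _)
    ((slice hft t ht).aestronglyMeasurable)
    (Filter.Eventually.of_forall fun u hu r hr => hC _ ⟨(r, u), ⟨hr, Set.uIoc_subset_uIcc hu⟩, rfl⟩)
    (continuous_const.intervalIntegrable _ _)
    (Filter.Eventually.of_forall fun u hu r hr => hasDerivAt_dt (p := (r, u))
      (differentiableAt_of_contDiffOn hU hf ⟨hball hr, trivial⟩))).2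
  convert! key using 1
  have e1 : ∫ u in (0 : ℝ)..P, du W (t, u) = 0 := by
    rw [intervalIntegral.integral_eq_sub_of_hasDerivAt (f := fun u => W (t, u))
      (fun u _ => hasDerivAt_du (p := (t, u))
        (differentiableAt_of_contDiffOn hU hW ⟨ht, trivial⟩))
      ((slice hWu t ht).intervalIntegrable _ _), hWP t ht, sub_self]
  have e2 : ∀ u, h (t, u) = dt f (t, u) - du W (t, u) := fun u => by
    rw [heq _ ⟨ht, trivial⟩]; ring
  simp only [e2]
  rw [intervalIntegral.integral_sub ((slice hft t ht).intervalIntegrable _ _)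
    ((slice hWu t ht).intervalIntegrable _ _), e1, sub_zero]

/-! ### Geometry of a closed immersed curve -/

theorem hasDerivAt_apply {c : ℝ → Plane} {c' : Plane} {u : ℝ} (h : HasDerivAt c c' u)
    (i : Fin 2) : HasDerivAt (fun w => c w i) (c' i) u :=
  (EuclideanSpace.proj (𝕜 := ℝ) i).hasFDerivAt.comp_hasDerivAt u h

theorem contDiff_arcDeriv {E : Type*} [NormedAddCommGroup E] [NormedSpace ℝ E]
    {c : ℝ → Plane} {f : ℝ → E} (hc : ContDiff ℝ ∞ c) (h0 : ∀ u, deriv c u ≠ 0)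
    (hf : ContDiff ℝ ∞ f) : ContDiff ℝ ∞ (arcDeriv c f) := by
  have h1 : ContDiff ℝ ∞ (deriv c) := (contDiff_infty_iff_deriv.1 hc).2
  have h2 : ContDiff ℝ ∞ (speed c) := h1.norm ℝ h0
  exact (h2.inv fun u => norm_ne_zero_iff.2 (h0 u)).smul (contDiff_infty_iff_deriv.1 hf).2

theorem inner_plane (z w : Plane) : inner ℝ z w = z 0 * w 0 + z 1 * w 1 := by
  simp [PiLp.inner_apply, Fin.sum_univ_two, mul_comm]

theorem sign_mul_self (ε : ℤˣ) : ((ε : ℤ) : ℝ) * ((ε : ℤ) : ℝ) = 1 := by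
  rcases Int.units_eq_one_or ε with h | h <;> simp [h]

theorem normal_apply_zero (ε : ℤˣ) (c : ℝ → Plane) (u : ℝ) :
    normal ε c u 0 = -(((ε : ℤ) : ℝ) * tangent c u 1) := by
  simp [normal, rot]

theorem normal_apply_one (ε : ℤˣ) (c : ℝ → Plane) (u : ℝ) :
    normal ε c u 1 = ((ε : ℤ) : ℝ) * tangent c u 0 := by
  simp [normal, rot]

theorem periodic_deriv {E : Type*} [NormedAddCommGroup E] [NormedSpace ℝ E] {P : ℝ} {f : ℝ → E}
    (hf : Function.Periodic f P) : Function.Periodic (deriv f) P := fun u => by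
  have : (fun w => f (w + P)) = f := funext hf
  rw [← deriv_comp_add_const, this]

namespace IsClosedImmersedCurve

variable {P : ℝ} {c : ℝ → Plane} (hc : IsClosedImmersedCurve P c)
include hc

theorem speed_pos (u : ℝ) : 0 < speed c u := norm_pos_iff.2 (hc.regular u)

theorem contDiff_deriv : ContDiff ℝ ∞ (deriv c) := (contDiff_infty_iff_deriv.1 hc.smooth).2

theorem contDiff_speed : ContDiff ℝ ∞ (speed c) := hc.contDiff_deriv.norm ℝ hc.regular

theorem contDiff_tangent : ContDiff ℝ ∞ (tangent c) :=
  contDiff_arcDeriv hc.smooth hc.regular hc.smooth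

theorem hasDerivAt_coord (i : Fin 2) (u : ℝ) :
    HasDerivAt (fun w => c w i) (speed c u * tangent c u i) u := by
  have := hasDerivAt_apply (hc.smooth.differentiable (by simp) u).hasDerivAt i
  refine this.congr_deriv ?_
  simp only [tangent, arcDeriv, PiLp.smul_apply, smul_eq_mul]
  rw [mul_inv_cancel_left₀ (hc.speed_pos u).ne']

theorem tangent_sq (u : ℝ) : tangent c u 0 ^ 2 + tangent c u 1 ^ 2 = 1 := by
  have h1 : ‖tangent c u‖ = 1 := by
    rw [tangent, arcDeriv, norm_smul, norm_inv, Real.norm_of_nonneg (hc.speed_pos u).le]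
    exact inv_mul_cancel₀ (hc.speed_pos u).ne'
  have h2 := EuclideanSpace.real_norm_sq_eq (tangent c u)
  rw [h1, Fin.sum_univ_two] at h2
  linarith

theorem hasDerivAt_tangent_coord (i : Fin 2) (u : ℝ) :
    HasDerivAt (fun w => tangent c w i) (deriv (tangent c) u i) u :=
  hasDerivAt_apply (hc.contDiff_tangent.differentiable (by simp) u).hasDerivAt i

omit hc in
theorem curvature_eq (ε : ℤˣ) (u : ℝ) :
    curvature ε c u = ((ε : ℤ) : ℝ) * (speed c u)⁻¹ *
      (tangent c u 0 * deriv (tangent c) u 1 - tangent c u 1 * deriv (tangent c) u 0) := by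
  rw [curvature, inner_plane, normal_apply_zero, normal_apply_one]
  simp only [arcDeriv, PiLp.smul_apply, smul_eq_mul]
  ring

theorem contDiff_curvature (ε : ℤˣ) : ContDiff ℝ ∞ (curvature ε c) := by
  have h1 := contDiff_arcDeriv hc.smooth hc.regular hc.contDiff_tangent
  have h2 := contDiff_euclidean.1 hc.contDiff_tangent
  have h3 : ContDiff ℝ ∞ (normal ε c) := by
    rw [contDiff_euclidean]
    intro i
    fin_cases i
    · simp only [Fin.zero_eta, normal_apply_zero]
      exact (contDiff_const.mul (h2 1)).neg
    · simp only [Fin.mk_one, normal_apply_one]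
      exact contDiff_const.mul (h2 0)
  exact h1.inner ℝ h3

theorem hasDerivAt_tangent_zero (ε : ℤˣ) (u : ℝ) : HasDerivAt (fun w => tangent c w 0)
    (-(((ε : ℤ) : ℝ) * curvature ε c u * speed c u) * tangent c u 1) u := by
  refine (hc.hasDerivAt_tangent_coord 0 u).congr_deriv ?_
  have h1 := (((hc.hasDerivAt_tangent_coord 0 u).fun_pow 2).add
    ((hc.hasDerivAt_tangent_coord 1 u).fun_pow 2)).unique
    ((hasDerivAt_const u (1 : ℝ)).congr_of_eventuallyEq
      (Filter.Eventually.of_forall fun w => hc.tangent_sq w))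
  have h2 := hc.tangent_sq u
  rw [curvature_eq]
  have := (hc.speed_pos u).ne'
  field_simp
  push_cast at h1
  simp only [pow_one] at h1
  rw [sq ((ε : ℤ) : ℝ), sign_mul_self]
  linear_combination (-deriv (tangent c) u 0) * h2 + tangent c u 0 / 2 * h1

theorem hasDerivAt_tangent_one (ε : ℤˣ) (u : ℝ) : HasDerivAt (fun w => tangent c w 1)
    (((ε : ℤ) : ℝ) * curvature ε c u * speed c u * tangent c u 0) u := by
  refine (hc.hasDerivAt_tangent_coord 1 u).congr_deriv ?_
  have h1 := (((hc.hasDerivAt_tangent_coord 0 u).fun_pow 2).add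
    ((hc.hasDerivAt_tangent_coord 1 u).fun_pow 2)).unique
    ((hasDerivAt_const u (1 : ℝ)).congr_of_eventuallyEq
      (Filter.Eventually.of_forall fun w => hc.tangent_sq w))
  have h2 := hc.tangent_sq u
  rw [curvature_eq]
  have := (hc.speed_pos u).ne'
  field_simp
  push_cast at h1
  simp only [pow_one] at h1
  rw [sq ((ε : ℤ) : ℝ), sign_mul_self]
  linear_combination (-deriv (tangent c) u 1) * h2 + tangent c u 1 / 2 * h1

theorem periodic_speed : Function.Periodic (speed c) P := fun u => by
  rw [speed, periodic_deriv hc.periodic, speed]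

theorem periodic_arcDeriv {E : Type*} [NormedAddCommGroup E] [NormedSpace ℝ E] {f : ℝ → E}
    (hf : Function.Periodic f P) : Function.Periodic (arcDeriv c f) P := fun u => by
  rw [arcDeriv, hc.periodic_speed, periodic_deriv hf, arcDeriv]

theorem periodic_tangent : Function.Periodic (tangent c) P := hc.periodic_arcDeriv hc.periodic

theorem periodic_curvature (ε : ℤˣ) : Function.Periodic (curvature ε c) P := fun u => by
  rw [curvature_eq, curvature_eq, hc.periodic_speed, hc.periodic_tangent,
    periodic_deriv hc.periodic_tangent]

theorem length_pos : 0 < length P c :=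
  intervalIntegral.intervalIntegral_pos_of_pos (hc.contDiff_speed.continuous.intervalIntegrable _ _)
    hc.speed_pos hc.period_pos

omit hc in
theorem signedArea_eq (ε : ℤˣ) : signedArea ε P c = ((ε : ℤ) : ℝ) / 2 *
    ∫ u in (0 : ℝ)..P, (c u 0 * tangent c u 1 - c u 1 * tangent c u 0) * speed c u := by
  rw [signedArea, arcIntegral, ← intervalIntegral.integral_const_mul,
    ← intervalIntegral.integral_const_mul]
  congr 1
  ext u
  rw [inner_plane, normal_apply_zero, normal_apply_one]
  ring

/-- `K_osc = L ∫ k² ds - (∫ k ds)²`. -/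
theorem oscCurvature_eq (ε : ℤˣ) : oscCurvature ε P c = length P c *
    arcIntegral P c (fun u => curvature ε c u ^ 2) - arcIntegral P c (curvature ε c) ^ 2 := by
  have := length_mul_integral_sub_sq hc.contDiff_speed.continuous
    (hc.contDiff_curvature ε).continuous hc.length_pos.ne'
  rw [oscCurvature, avgCurvature, one_div_mul_eq_div]
  exact this

/-- The isoperimetric inequality. -/
theorem four_pi_mul_signedArea_le (ε : ℤˣ) :
    4 * Real.pi * signedArea ε P c ≤ length P c ^ 2 := by
  have h2 := contDiff_euclidean.1 hc.contDiff_tangent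
  have := isoperimetric hc.period_pos hc.contDiff_speed.continuous hc.periodic_speed hc.speed_pos
    (h2 0).continuous (h2 1).continuous hc.tangent_sq (hc.hasDerivAt_coord 0)
    (hc.hasDerivAt_coord 1) (by simpa using congrArg (· 0) (hc.periodic 0))
    (by simpa using congrArg (· 1) (hc.periodic 0))
  refine le_trans ?_ this
  rw [signedArea_eq]
  have hpi := Real.pi_pos
  generalize (∫ u in (0 : ℝ)..P, (c u 0 * tangent c u 1 - c u 1 * tangent c u 0) * speed c u) = A
  have h3 : ((ε : ℤ) : ℝ) * A ≤ |A| := by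
    rcases Int.units_eq_one_or ε with h | h
    · simpa [h] using le_abs_self A
    · simpa [h] using neg_le_abs A
  calc 4 * Real.pi * (((ε : ℤ) : ℝ) / 2 * A) = 2 * Real.pi * (((ε : ℤ) : ℝ) * A) := by ring
    _ ≤ _ := mul_le_mul_of_nonneg_left h3 (by positivity)

/-- A closed curve with `L ∫ k² ds < 64` has no self-intersections. -/
theorem isEmbeddedCurve_of_lt (ε : ℤˣ)
    (h : length P c * arcIntegral P c (fun u => curvature ε c u ^ 2) < 64) :
    IsEmbeddedCurve P c := by
  refine ⟨hc, ?_⟩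
  have hv := hc.contDiff_speed.continuous
  have hk := (hc.contDiff_curvature ε).continuous
  have key : ∀ s t : ℝ, s < t → t < s + P → c t ≠ c s := fun s t hst htP heq => by
    refine absurd (sixty_four_le_of_self_intersection hv hc.speed_pos
      (κ := fun u => ((ε : ℤ) : ℝ) * curvature ε c u * speed c u) (by fun_prop) hc.tangent_sq
      (hc.hasDerivAt_coord 0) (hc.hasDerivAt_coord 1) (hc.hasDerivAt_tangent_zero ε)
      (hc.hasDerivAt_tangent_one ε) (fun u => by simp only [hc.periodic u])
      (fun u => by simp only [hc.periodic u])
      hc.periodic_speed (fun u => by simp only [hc.periodic_curvature ε u, hc.periodic_speed u])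
      hst htP (congrArg (· 0) heq) (congrArg (· 1) heq)) (not_le.2 ?_)
    convert! h using 2
    rw [arcIntegral]
    congr 1
    ext u
    have := (hc.speed_pos u).ne'
    field_simp
    rw [sq ((ε : ℤ) : ℝ), sign_mul_self, one_mul]
  intro s hs t ht hst
  rcases lt_trichotomy s t with h' | h' | h'
  · exact absurd hst.symm (key s t h' (by linarith [hs.1, ht.2]))
  · exact h'
  · exact absurd hst (key t s h' (by linarith [ht.1, hs.2]))

end IsClosedImmersedCurve

/-! ### Evolution identities -/

section Evolution

variable {U : Set (ℝ × ℝ)} {x y v a b k d e : ℝ × ℝ → ℝ} {σ : ℝ}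

/-- The scalar data of a family of curves `(x, y)` depending on `(t, u) ∈ U`: the speed `v`, the
unit tangent `(a, b)`, the curvature `k` with respect to the normal `σ (-b, a)`, and `d = k_s`,
`e = k_ss`; the normal velocity is `-e`. -/
structure FlowData (U : Set (ℝ × ℝ)) (σ : ℝ) (x y v a b k d e : ℝ × ℝ → ℝ) : Prop where
  isOpen : IsOpen U
  sign : σ * σ = 1
  smooth_x : ContDiffOn ℝ ∞ x U
  smooth_y : ContDiffOn ℝ ∞ y U
  smooth_v : ContDiffOn ℝ ∞ v U
  smooth_a : ContDiffOn ℝ ∞ a U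
  smooth_b : ContDiffOn ℝ ∞ b U
  smooth_k : ContDiffOn ℝ ∞ k U
  smooth_d : ContDiffOn ℝ ∞ d U
  smooth_e : ContDiffOn ℝ ∞ e U
  unit : ∀ p ∈ U, a p * a p + b p * b p = 1
  du_x : ∀ p ∈ U, du x p = v p * a p
  du_y : ∀ p ∈ U, du y p = v p * b p
  du_a : ∀ p ∈ U, du a p = -(σ * k p * v p) * b p
  du_b : ∀ p ∈ U, du b p = σ * k p * v p * a p
  du_k : ∀ p ∈ U, du k p = v p * d p
  du_d : ∀ p ∈ U, du d p = v p * e p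
  velocity : ∀ p ∈ U, σ * (a p * dt y p - b p * dt x p) = -e p

namespace FlowData

/-- The tangential velocity. -/
noncomputable def tangential (x y a b : ℝ × ℝ → ℝ) (p : ℝ × ℝ) : ℝ :=
  a p * dt x p + b p * dt y p

/-- The angular velocity `σ ⟨τ_t, rot τ⟩` of the unit tangent. -/
noncomputable def angular (σ : ℝ) (a b : ℝ × ℝ → ℝ) (p : ℝ × ℝ) : ℝ :=
  σ * (a p * dt b p - b p * dt a p)

variable (H : FlowData U σ x y v a b k d e)
include H

theorem diff {f : ℝ × ℝ → ℝ} (hf : ContDiffOn ℝ ∞ f U) {p : ℝ × ℝ} (hp : p ∈ U) :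
    DifferentiableAt ℝ f p := differentiableAt_of_contDiffOn H.isOpen hf hp

theorem smooth_dt {f : ℝ × ℝ → ℝ} (hf : ContDiffOn ℝ ∞ f U) : ContDiffOn ℝ ∞ (dt f) U :=
  contDiffOn_dt H.isOpen hf

theorem smooth_tangential : ContDiffOn ℝ ∞ (tangential x y a b) U :=
  (H.smooth_a.mul (H.smooth_dt H.smooth_x)).add (H.smooth_b.mul (H.smooth_dt H.smooth_y))

theorem smooth_angular : ContDiffOn ℝ ∞ (angular σ a b) U :=
  contDiffOn_const.mul
    ((H.smooth_a.mul (H.smooth_dt H.smooth_b)).sub (H.smooth_b.mul (H.smooth_dt H.smooth_a)))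

theorem unit_dt {p : ℝ × ℝ} (hp : p ∈ U) : a p * dt a p + b p * dt b p = 0 := by
  have ha := H.diff H.smooth_a hp
  have hb := H.diff H.smooth_b hp
  have h := dt_congr H.isOpen (f := fun p => a p * a p + b p * b p) (g := fun _ => 1) H.unit hp
  rw [dt_add (ha.fun_mul ha) (hb.fun_mul hb), dt_mul ha ha, dt_mul hb hb, dt_const] at h
  linarith

theorem dt_a {p : ℝ × ℝ} (hp : p ∈ U) : dt a p = -(σ * angular σ a b p * b p) := by
  simp only [angular]
  linear_combination (-dt a p) * H.unit p hp + a p * H.unit_dt hp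
    + (a p * dt b p - b p * dt a p) * b p * H.sign

theorem dt_b {p : ℝ × ℝ} (hp : p ∈ U) : dt b p = σ * angular σ a b p * a p := by
  simp only [angular]
  linear_combination (-dt b p) * H.unit p hp + b p * H.unit_dt hp
    - (a p * dt b p - b p * dt a p) * a p * H.sign

theorem dt_x {p : ℝ × ℝ} (hp : p ∈ U) :
    dt x p = tangential x y a b p * a p + σ * (e p * b p) := by
  simp only [tangential]
  linear_combination (-dt x p) * H.unit p hp - σ * b p * H.velocity p hp
    + (b p * (a p * dt y p - b p * dt x p)) * H.sign

theorem dt_y {p : ℝ × ℝ} (hp : p ∈ U) :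
    dt y p = tangential x y a b p * b p - σ * (e p * a p) := by
  simp only [tangential]
  linear_combination (-dt y p) * H.unit p hp + σ * a p * H.velocity p hp
    - (a p * (a p * dt y p - b p * dt x p)) * H.sign

/-- Both coordinates of `(v τ)_t = (φ τ + F ν)_u`, from the symmetry of second derivatives. -/
theorem velocity_system {p : ℝ × ℝ} (hp : p ∈ U) :
    (v p * dt a p + a p * dt v p = tangential x y a b p * du a p + a p * du (tangential x y a b) p
      + σ * (e p * du b p + b p * du e p)) ∧
    (v p * dt b p + b p * dt v p = tangential x y a b p * du b p + b p * du (tangential x y a b) p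
      - σ * (e p * du a p + a p * du e p)) := by
  have ha := H.diff H.smooth_a hp
  have hb := H.diff H.smooth_b hp
  have hv := H.diff H.smooth_v hp
  have he := H.diff H.smooth_e hp
  have hφ := H.diff H.smooth_tangential hp
  constructor
  · rw [← dt_mul hv ha, ← dt_congr H.isOpen H.du_x hp, dt_du_comm H.isOpen H.smooth_x hp,
      du_congr H.isOpen (fun q hq => H.dt_x hq) hp,
      du_add (hφ.fun_mul ha) ((differentiableAt_const σ).fun_mul (he.fun_mul hb)), du_mul hφ ha,
      du_mul (differentiableAt_const σ) (he.fun_mul hb), du_mul he hb, du_const]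
    ring
  · rw [← dt_mul hv hb, ← dt_congr H.isOpen H.du_y hp, dt_du_comm H.isOpen H.smooth_y hp,
      du_congr H.isOpen (fun q hq => H.dt_y hq) hp,
      du_sub (hφ.fun_mul hb) ((differentiableAt_const σ).fun_mul (he.fun_mul ha)), du_mul hφ hb,
      du_mul (differentiableAt_const σ) (he.fun_mul ha), du_mul he ha, du_const]
    ring

/-- The evolution of the speed: `v_t = φ_u + k k_ss v`. -/
theorem dt_v {p : ℝ × ℝ} (hp : p ∈ U) :
    dt v p = du (tangential x y a b) p + e p * k p * v p := by
  obtain ⟨h1, h2⟩ := H.velocity_system hp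
  rw [H.du_a p hp, H.du_b p hp] at h1 h2
  linear_combination a p * h1 + b p * h2 + (du (tangential x y a b) p - dt v p) * H.unit p hp
    - v p * H.unit_dt hp + e p * k p * v p * (H.sign + σ * σ * (H.unit p hp))

/-- The angular velocity of the tangent: `v g = k v φ - (k_ss)_u`. -/
theorem speed_mul_angular {p : ℝ × ℝ} (hp : p ∈ U) :
    v p * angular σ a b p = tangential x y a b p * (k p * v p) - du e p := by
  obtain ⟨h1, h2⟩ := H.velocity_system hp
  rw [H.du_a p hp, H.du_b p hp] at h1 h2
  simp only [angular]
  linear_combination (-σ * b p) * h1 + σ * a p * h2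
    + (tangential x y a b p * (k p * v p) - du e p) * (H.sign + σ * σ * (H.unit p hp))

/-- `(k v)_t` is the `u`-derivative of the angular velocity of the tangent. -/
theorem dt_curvature_mul_speed {p : ℝ × ℝ} (hp : p ∈ U) :
    dt (fun q => k q * v q) p = du (angular σ a b) p := by
  have ha := H.diff H.smooth_a hp
  have hb := H.diff H.smooth_b hp
  have hau := H.diff (contDiffOn_du H.isOpen H.smooth_a) hp
  have hbu := H.diff (contDiffOn_du H.isOpen H.smooth_b) hp
  have hat := H.diff (H.smooth_dt H.smooth_a) hp
  have hbt := H.diff (H.smooth_dt H.smooth_b) hp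
  have e1 : Set.EqOn (fun q => k q * v q) (fun q => σ * (a q * du b q - b q * du a q)) U :=
    fun q hq => by
      simp only [H.du_a q hq, H.du_b q hq]
      linear_combination (-(k q * v q)) * (H.sign + σ * σ * (H.unit q hq))
  have e2 : du (angular σ a b) p = du (fun q => σ * (a q * dt b q - b q * dt a q)) p := rfl
  rw [dt_congr H.isOpen e1 hp, e2,
    dt_mul (differentiableAt_const σ) ((ha.fun_mul hbu).fun_sub (hb.fun_mul hau)),
    dt_sub (ha.fun_mul hbu) (hb.fun_mul hau), dt_mul ha hbu, dt_mul hb hau,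
    du_mul (differentiableAt_const σ) ((ha.fun_mul hbt).fun_sub (hb.fun_mul hat)),
    du_sub (ha.fun_mul hbt) (hb.fun_mul hat), du_mul ha hbt, du_mul hb hat,
    dt_du_comm H.isOpen H.smooth_a hp, dt_du_comm H.isOpen H.smooth_b hp, dt_const, du_const,
    H.du_a p hp, H.du_b p hp, H.dt_a hp, H.dt_b hp]
  ring

/-- Up to a total derivative, `v_t = -k_s² v`. -/
theorem dt_v_eq {p : ℝ × ℝ} (hp : p ∈ U) :
    dt v p = -(d p ^ 2 * v p) + du (fun q => tangential x y a b q + k q * d q) p := by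
  have hk := H.diff H.smooth_k hp
  have hd := H.diff H.smooth_d hp
  rw [du_add (H.diff H.smooth_tangential hp) (hk.fun_mul hd), du_mul hk hd, H.du_k p hp,
    H.du_d p hp,
    H.dt_v hp]
  ring

/-- Up to a total derivative, `(k² v)_t = (-2 k_ss² + 3 k² k_s²) v`. -/
theorem dt_curvature_sq_mul_speed {p : ℝ × ℝ} (hp : p ∈ U) :
    dt (fun q => k q * (k q * v q)) p = -2 * e p ^ 2 * v p + 3 * k p ^ 2 * d p ^ 2 * v p
      + du (fun q => ((k q * (2 * angular σ a b q) - k q * (k q * tangential x y a b q))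
        + (d q * (2 * e q) - k q * (k q * (k q * d q))))) p := by
  have hk := H.diff H.smooth_k hp
  have hd := H.diff H.smooth_d hp
  have he := H.diff H.smooth_e hp
  have hv := H.diff H.smooth_v hp
  have hφ := H.diff H.smooth_tangential hp
  have hg := H.diff H.smooth_angular hp
  have c2 : DifferentiableAt ℝ (fun _ : ℝ × ℝ => (2 : ℝ)) p := differentiableAt_const _
  have h1 := H.dt_curvature_mul_speed hp
  have h2 := H.speed_mul_angular hp
  have h3 := H.dt_v hp
  rw [du_add ((hk.fun_mul (c2.fun_mul hg)).fun_sub (hk.fun_mul (hk.fun_mul hφ)))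
      ((hd.fun_mul (c2.fun_mul he)).fun_sub (hk.fun_mul (hk.fun_mul (hk.fun_mul hd)))),
    du_sub (hk.fun_mul (c2.fun_mul hg)) (hk.fun_mul (hk.fun_mul hφ)),
    du_sub (hd.fun_mul (c2.fun_mul he)) (hk.fun_mul (hk.fun_mul (hk.fun_mul hd))),
    du_mul hk (c2.fun_mul hg), du_mul c2 hg, du_mul hk (hk.fun_mul hφ), du_mul hk hφ,
    du_mul hd (c2.fun_mul he), du_mul c2 he, du_mul hk (hk.fun_mul (hk.fun_mul hd)),
    du_mul hk (hk.fun_mul hd),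
    du_mul hk hd, du_const, H.du_k p hp, H.du_d p hp, dt_mul hk (hk.fun_mul hv), h1]
  rw [dt_mul hk hv] at h1
  linear_combination k p * h1 - k p ^ 2 * h3 - 2 * d p * h2

/-- The area density changes by a total derivative, since `∫ k_ss ds = 0`. -/
theorem dt_area {p : ℝ × ℝ} (hp : p ∈ U) :
    dt (fun q => x q * (v q * b q) - y q * (v q * a q)) p
      = 0 + du (fun q => (x q * dt y q - y q * dt x q) + 2 * σ * d q) p := by
  have hx := H.diff H.smooth_x hp
  have hy := H.diff H.smooth_y hp
  have hd := H.diff H.smooth_d hp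
  have hxu := H.diff (contDiffOn_du H.isOpen H.smooth_x) hp
  have hyu := H.diff (contDiffOn_du H.isOpen H.smooth_y) hp
  have hxt := H.diff (H.smooth_dt H.smooth_x) hp
  have hyt := H.diff (H.smooth_dt H.smooth_y) hp
  have c2 : DifferentiableAt ℝ (fun _ : ℝ × ℝ => (2 * σ : ℝ)) p := differentiableAt_const _
  rw [dt_congr H.isOpen (g := fun q => x q * du y q - y q * du x q)
      (fun q hq => by simp only [H.du_x q hq, H.du_y q hq]) hp,
    dt_sub (hx.fun_mul hyu) (hy.fun_mul hxu), dt_mul hx hyu, dt_mul hy hxu,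
    du_add ((hx.fun_mul hyt).fun_sub (hy.fun_mul hxt)) (c2.fun_mul hd),
    du_sub (hx.fun_mul hyt) (hy.fun_mul hxt),
    du_mul hx hyt, du_mul hy hxt, du_mul c2 hd, du_const, dt_du_comm H.isOpen H.smooth_x hp,
    dt_du_comm H.isOpen H.smooth_y hp, H.du_x p hp, H.du_y p hp, H.du_d p hp, H.dt_x hp,
    H.dt_y hp]
  linear_combination (2 * σ * v p * e p) * H.unit p hp

end FlowData

end Evolution

/-! ### Integral quantities along the flow -/

theorem deriv_snd {U : Set (ℝ × ℝ)} (hU : IsOpen U) {f : ℝ × ℝ → ℝ} (hf : ContDiffOn ℝ ∞ f U)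
    {t u : ℝ} (hp : (t, u) ∈ U) : deriv (fun w => f (t, w)) u = du f (t, u) :=
  (hasDerivAt_du (p := (t, u)) (differentiableAt_of_contDiffOn hU hf hp)).deriv

theorem dt_eq_of_eq {S : Set ℝ} (hS : IsOpen S) {f : ℝ × ℝ → ℝ}
    (hf : ContDiffOn ℝ ∞ f (S ×ˢ Set.univ)) {P : ℝ} (h : ∀ t ∈ S, f (t, P) = f (t, 0))
    {t : ℝ} (ht : t ∈ S) : dt f (t, P) = dt f (t, 0) := by
  have hU : IsOpen (S ×ˢ (Set.univ : Set ℝ)) := hS.prod isOpen_univ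
  have h1 := hasDerivAt_dt (p := (t, P))
    (differentiableAt_of_contDiffOn hU hf ⟨ht, trivial⟩)
  have h2 := hasDerivAt_dt (p := (t, 0))
    (differentiableAt_of_contDiffOn hU hf ⟨ht, trivial⟩)
  refine h1.unique (h2.congr_of_eventuallyEq ?_)
  filter_upwards [hS.mem_nhds ht] with r hr using h r hr

theorem continuousOn_integral {S : Set ℝ} {f : ℝ × ℝ → ℝ} (P : ℝ)
    (hf : ContinuousOn f (S ×ˢ Set.univ)) :
    ContinuousOn (fun t => ∫ u in (0 : ℝ)..P, f (t, u)) S := by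
  rw [continuousOn_iff_continuous_domRestrict]
  refine intervalIntegral.continuous_parametric_intervalIntegral_of_continuous'
    (f := fun (t : S) u => f (t, u)) ?_ 0 P
  exact hf.comp_continuous (f := fun q : S × ℝ => ((q.1 : ℝ), q.2)) (by fun_prop)
    fun q => ⟨q.1.2, trivial⟩

/-- The curvature in terms of the first two parameter derivatives. -/
theorem IsClosedImmersedCurve.curvature_eq_iteratedDeriv {P : ℝ} {c : ℝ → Plane}
    (hc : IsClosedImmersedCurve P c) (ε : ℤˣ) (u : ℝ) :
    curvature ε c u = ((ε : ℤ) : ℝ) / ‖iteratedDeriv 1 c u‖ ^ 3 *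
      (iteratedDeriv 1 c u 0 * iteratedDeriv 2 c u 1
        - iteratedDeriv 1 c u 1 * iteratedDeriv 2 c u 0) := by
  have h2 : iteratedDeriv 2 c = deriv (deriv c) := by
    rw [iteratedDeriv_succ, iteratedDeriv_one]
  have hs := hc.contDiff_speed.differentiable (by simp) u
  have coord : ∀ i w, deriv c w i = speed c w * tangent c w i := fun i w =>
    (hasDerivAt_apply (hc.smooth.differentiable (by simp) w).hasDerivAt i).unique
      (hc.hasDerivAt_coord i w)
  have hdd : ∀ i, HasDerivAt (fun w => deriv c w i) (deriv (deriv c) u i) u := fun i =>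
    hasDerivAt_apply (hc.contDiff_deriv.differentiable (by simp) u).hasDerivAt i
  have e0 := (hdd 0).unique (
    (hs.hasDerivAt.mul (hc.hasDerivAt_tangent_zero ε u)).congr_of_eventuallyEq
    (Filter.Eventually.of_forall (coord 0)))
  have e1 := (hdd 1).unique (
    (hs.hasDerivAt.mul (hc.hasDerivAt_tangent_one ε u)).congr_of_eventuallyEq
    (Filter.Eventually.of_forall (coord 1)))
  rw [h2, iteratedDeriv_one, e0, e1, coord, coord]
  change _ = _ / speed c u ^ 3 * _
  have := (hc.speed_pos u).ne'
  field_simp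
  linear_combination (-curvature ε c u * speed c u ^ 2) * (sign_mul_self ε
    + ((ε : ℤ) : ℝ) * ((ε : ℤ) : ℝ) * hc.tangent_sq u)

namespace IsCurveDiffusionFlow

variable {ε : ℤˣ} {P : ℝ} {T : EReal} {γ : ℝ → ℝ → Plane} (hγ : IsCurveDiffusionFlow ε P T γ)

theorem isOpen_times (T : EReal) : IsOpen {t : ℝ | 0 < t ∧ (t : EReal) < T} :=
  isOpen_Ioi.inter (isOpen_Iio.preimage continuous_coe_real_ereal)

include hγ

/-- A curve diffusion flow provides `FlowData` at positive times. -/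
theorem flowData : FlowData ({t : ℝ | 0 < t ∧ (t : EReal) < T} ×ˢ Set.univ) ((ε : ℤ) : ℝ)
    (fun p => γ p.1 p.2 0) (fun p => γ p.1 p.2 1) (fun p => speed (γ p.1) p.2)
    (fun p => tangent (γ p.1) p.2 0) (fun p => tangent (γ p.1) p.2 1)
    (fun p => curvature ε (γ p.1) p.2) (fun p => arcDeriv (γ p.1) (curvature ε (γ p.1)) p.2)
    (fun p => arcDeriv (γ p.1) (arcDeriv (γ p.1) (curvature ε (γ p.1))) p.2) := by
  set U := {t : ℝ | 0 < t ∧ (t : EReal) < T} ×ˢ (Set.univ : Set ℝ) with hUdef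
  have hU : IsOpen U := (isOpen_times T).prod isOpen_univ
  have himm : ∀ p ∈ U, IsClosedImmersedCurve P (γ p.1) := fun p hp =>
    hγ.immersed p.1 hp.1.1.le hp.1.2
  have hcoord := contDiffOn_euclidean.1 hγ.smooth
  have hsigma := sign_mul_self ε
  have hdu : ∀ i, ∀ p ∈ U, du (fun q => γ q.1 q.2 i) p
      = speed (γ p.1) p.2 * tangent (γ p.1) p.2 i := fun i p hp =>
    (hasDerivAt_du (differentiableAt_of_contDiffOn hU (hcoord i) hp)).unique
      ((himm p hp).hasDerivAt_coord i p.2)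
  have hpos : ∀ p ∈ U, 0 < speed (γ p.1) p.2 := fun p hp => (himm p hp).speed_pos p.2
  have hsq : ∀ p ∈ U, du (fun q => γ q.1 q.2 0) p ^ 2 + du (fun q => γ q.1 q.2 1) p ^ 2
      = speed (γ p.1) p.2 ^ 2 := fun p hp => by
    rw [hdu 0 p hp, hdu 1 p hp]
    linear_combination speed (γ p.1) p.2 ^ 2 * (himm p hp).tangent_sq p.2
  have hv : ContDiffOn ℝ ∞ (fun p : ℝ × ℝ => speed (γ p.1) p.2) U := by
    refine (ContDiffOn.sqrt (((contDiffOn_du hU (hcoord 0)).pow 2).add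
      ((contDiffOn_du hU (hcoord 1)).pow 2)) fun p hp => ?_).congr fun p hp => ?_
    · rw [hsq p hp]
      exact (pow_pos (hpos p hp) 2).ne'
    · rw [hsq p hp, Real.sqrt_sq (hpos p hp).le]
  have hvinv : ContDiffOn ℝ ∞ (fun p : ℝ × ℝ => (speed (γ p.1) p.2)⁻¹) U :=
    hv.inv fun p hp => (hpos p hp).ne'
  have htan : ∀ i, ContDiffOn ℝ ∞ (fun p : ℝ × ℝ => tangent (γ p.1) p.2 i) U := fun i =>
    (hvinv.mul (contDiffOn_du hU (hcoord i))).congr fun p hp => by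
      rw [hdu i p hp, inv_mul_cancel_left₀ (hpos p hp).ne']
  have hdua : ∀ p ∈ U, du (fun q : ℝ × ℝ => tangent (γ q.1) q.2 0) p = _ := fun p hp =>
    (hasDerivAt_du (differentiableAt_of_contDiffOn hU (htan 0) hp)).unique
      ((himm p hp).hasDerivAt_tangent_zero ε p.2)
  have hdub : ∀ p ∈ U, du (fun q : ℝ × ℝ => tangent (γ q.1) q.2 1) p = _ := fun p hp =>
    (hasDerivAt_du (differentiableAt_of_contDiffOn hU (htan 1) hp)).unique
      ((himm p hp).hasDerivAt_tangent_one ε p.2)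
  have hk : ContDiffOn ℝ ∞ (fun p : ℝ × ℝ => curvature ε (γ p.1) p.2) U := by
    refine ((contDiffOn_const (c := ((ε : ℤ) : ℝ))).mul (hvinv.mul
      (((htan 0).mul (contDiffOn_du hU (htan 1))).sub
        ((htan 1).mul (contDiffOn_du hU (htan 0)))))).congr fun p hp => ?_
    rw [hdua p hp, hdub p hp]
    have := (hpos p hp).ne'
    field_simp
    linear_combination (-curvature ε (γ p.1) p.2) * (hsigma
      + ((ε : ℤ) : ℝ) * ((ε : ℤ) : ℝ) * (himm p hp).tangent_sq p.2)
  have harc : ∀ {f : ℝ → ℝ → ℝ}, ContDiffOn ℝ ∞ (fun p : ℝ × ℝ => f p.1 p.2) U →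
      ContDiffOn ℝ ∞ (fun p : ℝ × ℝ => arcDeriv (γ p.1) (f p.1) p.2) U ∧
      ∀ p ∈ U, du (fun q : ℝ × ℝ => f q.1 q.2) p
        = speed (γ p.1) p.2 * arcDeriv (γ p.1) (f p.1) p.2 := fun {f} hf => by
    have hd : ∀ p ∈ U, arcDeriv (γ p.1) (f p.1) p.2
        = (speed (γ p.1) p.2)⁻¹ * du (fun q : ℝ × ℝ => f q.1 q.2) p := fun p hp => by
      rw [arcDeriv, smul_eq_mul, ← deriv_snd (t := p.1) (u := p.2) hU hf hp]
    refine ⟨(hvinv.mul (contDiffOn_du hU hf)).congr hd, fun p hp => ?_⟩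
    rw [hd p hp, mul_inv_cancel_left₀ (hpos p hp).ne']
  have hd := harc (f := fun t => curvature ε (γ t)) hk
  have he := harc (f := fun t => arcDeriv (γ t) (curvature ε (γ t))) hd.1
  refine ⟨hU, hsigma, hcoord 0, hcoord 1, hv, htan 0, htan 1, hk, hd.1, he.1, fun p hp => ?_,
    hdu 0, hdu 1, hdua, hdub, hd.2, he.2, fun p hp => ?_⟩
  · linear_combination (himm p hp).tangent_sq p.2
  · have hdiff : DifferentiableAt ℝ (fun r => γ r p.2) p.1 :=
      DifferentiableAt.comp (f := fun r : ℝ => (r, p.2)) p.1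
        (g := fun q : ℝ × ℝ => γ q.1 q.2)
        ((hγ.smooth.contDiffAt (hU.mem_nhds hp)).differentiableAt (by simp)) (by fun_prop)
    have hdt : ∀ i, dt (fun q => γ q.1 q.2 i) p = deriv (fun r => γ r p.2) p.1 i := fun i =>
      (hasDerivAt_dt (differentiableAt_of_contDiffOn hU (hcoord i) hp)).unique
        (hasDerivAt_apply hdiff.hasDerivAt i)
    rw [hdt, hdt, ← hγ.normal_velocity p.1 hp.1.1 hp.1.2 p.2, inner_plane, normal_apply_zero,
      normal_apply_one]
    ring

theorem tangential_periodic {t : ℝ} (ht : t ∈ {t : ℝ | 0 < t ∧ (t : EReal) < T}) :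
    FlowData.tangential (fun p => γ p.1 p.2 0) (fun p => γ p.1 p.2 1)
      (fun p => tangent (γ p.1) p.2 0) (fun p => tangent (γ p.1) p.2 1) (t, P)
    = FlowData.tangential (fun p => γ p.1 p.2 0) (fun p => γ p.1 p.2 1)
      (fun p => tangent (γ p.1) p.2 0) (fun p => tangent (γ p.1) p.2 1) (t, 0) := by
  have H := hγ.flowData
  have hc : ∀ r ∈ {t : ℝ | 0 < t ∧ (t : EReal) < T}, IsClosedImmersedCurve P (γ r) :=
    fun r hr => hγ.immersed r hr.1.le hr.2
  simp only [FlowData.tangential]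
  rw [dt_eq_of_eq (isOpen_times T) H.smooth_x (fun r hr => by simp only [(hc r hr).periodic.eq]) ht,
    dt_eq_of_eq (isOpen_times T) H.smooth_y (fun r hr => by simp only [(hc r hr).periodic.eq]) ht,
    (hc t ht).periodic_tangent.eq]

theorem angular_periodic {t : ℝ} (ht : t ∈ {t : ℝ | 0 < t ∧ (t : EReal) < T}) :
    FlowData.angular ((ε : ℤ) : ℝ)
      (fun p => tangent (γ p.1) p.2 0) (fun p => tangent (γ p.1) p.2 1) (t, P)
    = FlowData.angular ((ε : ℤ) : ℝ)
      (fun p => tangent (γ p.1) p.2 0) (fun p => tangent (γ p.1) p.2 1) (t, 0) := by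
  have H := hγ.flowData
  have hc : ∀ r ∈ {t : ℝ | 0 < t ∧ (t : EReal) < T}, IsClosedImmersedCurve P (γ r) :=
    fun r hr => hγ.immersed r hr.1.le hr.2
  simp only [FlowData.angular]
  rw [dt_eq_of_eq (isOpen_times T) H.smooth_a
      (fun r hr => by simp only [(hc r hr).periodic_tangent.eq]) ht,
    dt_eq_of_eq (isOpen_times T) H.smooth_b
      (fun r hr => by simp only [(hc r hr).periodic_tangent.eq]) ht,
    (hc t ht).periodic_tangent.eq]

/-- `L' = -∫ k_s² ds`. -/
theorem hasDerivAt_length {t : ℝ} (h0 : 0 < t) (hT : (t : EReal) < T) :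
    HasDerivAt (fun r => length P (γ r)) (∫ u in (0 : ℝ)..P,
      -(arcDeriv (γ t) (curvature ε (γ t)) u ^ 2 * speed (γ t) u)) t := by
  have H := hγ.flowData
  refine hasDerivAt_integral_of_dt_eq (isOpen_times T) H.smooth_v
    (H.smooth_tangential.add (H.smooth_k.mul H.smooth_d)) (fun r hr => ?_)
    (fun p hp => H.dt_v_eq hp) ⟨h0, hT⟩
  have hc := hγ.immersed r hr.1.le hr.2
  simp only [hγ.tangential_periodic hr, (hc.periodic_curvature ε).eq,
    (hc.periodic_arcDeriv (hc.periodic_curvature ε)).eq]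

/-- The total curvature is constant. -/
theorem hasDerivAt_totalCurvature {t : ℝ} (h0 : 0 < t) (hT : (t : EReal) < T) :
    HasDerivAt (fun r => arcIntegral P (γ r) (curvature ε (γ r))) 0 t := by
  have H := hγ.flowData
  have := hasDerivAt_integral_of_dt_eq (isOpen_times T) (P := P) (h := fun _ => 0)
    (H.smooth_k.mul H.smooth_v) H.smooth_angular
    (fun r hr => hγ.angular_periodic hr)
    (fun p hp => by rw [zero_add]; exact H.dt_curvature_mul_speed hp) ⟨h0, hT⟩
  rw [intervalIntegral.integral_zero] at this
  exact this

/-- `(∫ k² ds)' = ∫ (-2 k_ss² + 3 k² k_s²) ds`. -/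
theorem hasDerivAt_elasticEnergy {t : ℝ} (h0 : 0 < t) (hT : (t : EReal) < T) :
    HasDerivAt (fun r => arcIntegral P (γ r) (fun u => curvature ε (γ r) u ^ 2))
      (∫ u in (0 : ℝ)..P, (-2 * arcDeriv (γ t) (arcDeriv (γ t) (curvature ε (γ t))) u ^ 2
          * speed (γ t) u
        + 3 * curvature ε (γ t) u ^ 2 * arcDeriv (γ t) (curvature ε (γ t)) u ^ 2
          * speed (γ t) u)) t := by
  have H := hγ.flowData
  have key := hasDerivAt_integral_of_dt_eq (isOpen_times T) (P := P)
    (H.smooth_k.mul (H.smooth_k.mul H.smooth_v))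
    (((H.smooth_k.mul (contDiffOn_const.mul H.smooth_angular)).sub
      (H.smooth_k.mul (H.smooth_k.mul H.smooth_tangential))).add
      ((H.smooth_d.mul (contDiffOn_const.mul H.smooth_e)).sub
        (H.smooth_k.mul (H.smooth_k.mul (H.smooth_k.mul H.smooth_d)))))
    (fun r hr => by
      have hc := hγ.immersed r hr.1.le hr.2
      have hkP := hc.periodic_curvature ε
      simp only [hγ.tangential_periodic hr,
        hγ.angular_periodic hr, hkP.eq, (hc.periodic_arcDeriv hkP).eq,
        (hc.periodic_arcDeriv (hc.periodic_arcDeriv hkP)).eq])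
    (fun p hp => H.dt_curvature_sq_mul_speed hp) (t := t) ⟨h0, hT⟩
  refine key.congr_of_eventuallyEq (Filter.Eventually.of_forall fun r => ?_)
  simp only [arcIntegral]
  congr 1
  ext u
  ring

/-- The enclosed area is constant. -/
theorem hasDerivAt_signedArea {t : ℝ} (h0 : 0 < t) (hT : (t : EReal) < T) :
    HasDerivAt (fun r => signedArea ε P (γ r)) 0 t := by
  have H := hγ.flowData
  have key := hasDerivAt_integral_of_dt_eq (isOpen_times T) (P := P) (h := fun _ => 0)
    ((H.smooth_x.mul (H.smooth_v.mul H.smooth_b)).sub (H.smooth_y.mul (H.smooth_v.mul H.smooth_a)))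
    (((H.smooth_x.mul (H.smooth_dt H.smooth_y)).sub (H.smooth_y.mul (H.smooth_dt H.smooth_x))).add
      (contDiffOn_const.mul H.smooth_d))
    (fun r hr => by
      have hc : ∀ r ∈ {t : ℝ | 0 < t ∧ (t : EReal) < T}, IsClosedImmersedCurve P (γ r) :=
        fun r hr => hγ.immersed r hr.1.le hr.2
      dsimp only
      rw [dt_eq_of_eq (isOpen_times T) H.smooth_x
          (fun r hr => by simp only [(hc r hr).periodic.eq]) hr,
        dt_eq_of_eq (isOpen_times T) H.smooth_y
          (fun r hr => by simp only [(hc r hr).periodic.eq]) hr, (hc r hr).periodic.eq,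
        ((hc r hr).periodic_arcDeriv ((hc r hr).periodic_curvature ε)).eq])
    (fun p hp => H.dt_area hp) (t := t) ⟨h0, hT⟩
  rw [intervalIntegral.integral_zero] at key
  have := key.const_mul (((ε : ℤ) : ℝ) / 2)
  rw [mul_zero] at this
  refine this.congr_of_eventuallyEq (Filter.Eventually.of_forall fun r => ?_)
  dsimp only
  rw [IsClosedImmersedCurve.signedArea_eq]
  congr 2
  ext u
  ring

theorem continuousOn_speed : ContinuousOn (fun p : ℝ × ℝ => speed (γ p.1) p.2)
    ({t : ℝ | 0 ≤ t ∧ (t : EReal) < T} ×ˢ Set.univ) := by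
  have := (hγ.continuous 1 (by norm_num)).norm
  simp only [iteratedDeriv_one] at this
  exact this

theorem continuousOn_coord (j : ℕ) (hj : j ≤ 2) (i : Fin 2) :
    ContinuousOn (fun p : ℝ × ℝ => iteratedDeriv j (γ p.1) p.2 i)
    ({t : ℝ | 0 ≤ t ∧ (t : EReal) < T} ×ˢ Set.univ) :=
  (EuclideanSpace.proj (𝕜 := ℝ) i).continuous.comp_continuousOn (hγ.continuous j hj)

theorem continuousOn_curvature : ContinuousOn (fun p : ℝ × ℝ => curvature ε (γ p.1) p.2)
    ({t : ℝ | 0 ≤ t ∧ (t : EReal) < T} ×ˢ Set.univ) := by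
  have h1 := hγ.continuousOn_coord 1 (by norm_num)
  have h2 := hγ.continuousOn_coord 2 le_rfl
  refine (((continuousOn_const (c := ((ε : ℤ) : ℝ))).div
    ((hγ.continuous 1 (by norm_num)).norm.pow 3) fun p hp => ?_).mul
    (((h1 0).mul (h2 1)).sub ((h1 1).mul (h2 0)))).congr fun p hp =>
      (hγ.immersed p.1 hp.1.1 hp.1.2).curvature_eq_iteratedDeriv ε p.2
  rw [Pi.pow_apply, iteratedDeriv_one]
  exact (pow_pos ((hγ.immersed p.1 hp.1.1 hp.1.2).speed_pos p.2) 3).ne'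

theorem continuousOn_length : ContinuousOn (fun t => length P (γ t))
    {t : ℝ | 0 ≤ t ∧ (t : EReal) < T} := continuousOn_integral P hγ.continuousOn_speed

theorem continuousOn_totalCurvature :
    ContinuousOn (fun t => arcIntegral P (γ t) (curvature ε (γ t)))
    {t : ℝ | 0 ≤ t ∧ (t : EReal) < T} :=
  continuousOn_integral P (hγ.continuousOn_curvature.mul hγ.continuousOn_speed)

theorem continuousOn_elasticEnergy :
    ContinuousOn (fun t => arcIntegral P (γ t) (fun u => curvature ε (γ t) u ^ 2))
    {t : ℝ | 0 ≤ t ∧ (t : EReal) < T} :=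
  continuousOn_integral P ((hγ.continuousOn_curvature.pow 2).mul hγ.continuousOn_speed)

theorem continuousOn_signedArea : ContinuousOn (fun t => signedArea ε P (γ t))
    {t : ℝ | 0 ≤ t ∧ (t : EReal) < T} := by
  have h0 := hγ.continuousOn_coord 0 (by norm_num)
  have h1 := hγ.continuousOn_coord 1 (by norm_num)
  simp only [iteratedDeriv_zero] at h0
  refine ((continuousOn_integral P (((h0 0).mul (h1 1)).sub ((h0 1).mul (h1 0)))).const_mul
    (((ε : ℤ) : ℝ) / 2)).congr fun t ht => ?_
  rw [IsClosedImmersedCurve.signedArea_eq]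
  have hc := hγ.immersed t ht.1 ht.2
  have coord : ∀ i w, deriv (γ t) w i = speed (γ t) w * tangent (γ t) w i := fun i w =>
    (hasDerivAt_apply (hc.smooth.differentiable (by simp) w).hasDerivAt i).unique
      (hc.hasDerivAt_coord i w)
  dsimp only
  congr 2
  ext u
  simp only [iteratedDeriv_one, Pi.sub_apply, Pi.mul_apply, coord]
  ring

end IsCurveDiffusionFlow

/-! ### Preservation of small curvature oscillation -/

theorem Kstar_eq : Kstar = 2 * Real.pi / (3 * (2 * (3 * Real.pi + 1 / 2
    + Real.sqrt (3 * Real.pi) * Real.sqrt (1 + 3 * Real.pi)))) := by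
  have hpi := Real.pi_pos
  have h1 := Real.sq_sqrt (by positivity : 0 ≤ 3 * Real.pi)
  have h2 := Real.sq_sqrt (by positivity : 0 ≤ 1 + 3 * Real.pi)
  rw [Kstar, eq_div_iff (by positivity)]
  linear_combination (-8 * Real.pi * Real.sqrt (1 + 3 * Real.pi) ^ 2) * h1
    - 24 * Real.pi ^ 2 * h2

theorem Kstar_pos : 0 < Kstar := by
  rw [Kstar_eq]
  have hpi := Real.pi_pos
  positivity

theorem Kstar_le : Kstar ≤ 1 / 18 := by
  have hpi := Real.pi_pos
  rw [Kstar_eq, div_le_iff₀ (by positivity)]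
  have h1 : Real.sqrt (3 * Real.pi) ≤ Real.sqrt (1 + 3 * Real.pi) :=
    Real.sqrt_le_sqrt (by linarith)
  have h2 : Real.sqrt (3 * Real.pi) * Real.sqrt (3 * Real.pi)
      ≤ Real.sqrt (3 * Real.pi) * Real.sqrt (1 + 3 * Real.pi) :=
    mul_le_mul_of_nonneg_left h1 (Real.sqrt_nonneg _)
  rw [Real.mul_self_sqrt (by positivity)] at h2
  linarith

theorem four_mul_pi_sq_lt : 4 * Real.pi ^ 2 < 40 := by
  have h1 := Real.pi_lt_d2
  have h2 := Real.pi_pos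
  nlinarith

theorem exists_sub_eq_of_hasDerivAt {f : ℝ → ℝ} {b : ℝ} (hb : 0 < b) {s : Set ℝ}
    (hs : Set.Icc 0 b ⊆ s) (hf : ContinuousOn f s) (f' : ℝ → ℝ)
    (hf' : ∀ t ∈ Set.Ioo 0 b, HasDerivAt f (f' t) t) :
    ∃ t ∈ Set.Ioo 0 b, f b - f 0 = f' t * b := by
  obtain ⟨t, ht, h⟩ := exists_hasDerivAt_eq_slope f f' hb (hf.mono hs) hf'
  refine ⟨t, ht, ?_⟩
  rw [h, sub_zero, div_mul_cancel₀ _ hb.ne']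

namespace IsCurveDiffusionFlow

variable {ε : ℤˣ} {P : ℝ} {T : EReal} {γ : ℝ → ℝ → Plane} (hγ : IsCurveDiffusionFlow ε P T γ)

theorem Icc_subset_times {b : ℝ} (hT : (b : EReal) < T) :
    Set.Icc 0 b ⊆ {t : ℝ | 0 ≤ t ∧ (t : EReal) < T} := fun _ ht =>
  ⟨ht.1, lt_of_le_of_lt (EReal.coe_le_coe_iff.2 ht.2) hT⟩

include hγ

theorem totalCurvature_eq {b : ℝ} (hb : 0 ≤ b) (hT : (b : EReal) < T) :
    arcIntegral P (γ b) (curvature ε (γ b)) = arcIntegral P (γ 0) (curvature ε (γ 0)) := by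
  rcases hb.eq_or_lt with rfl | hb
  · rfl
  obtain ⟨t, -, h⟩ := exists_sub_eq_of_hasDerivAt hb (Icc_subset_times hT)
    hγ.continuousOn_totalCurvature (fun _ => 0)
    fun t ht => hγ.hasDerivAt_totalCurvature ht.1 (Icc_subset_times hT ⟨ht.1.le, ht.2.le⟩).2
  linarith

theorem signedArea_eq {b : ℝ} (hb : 0 ≤ b) (hT : (b : EReal) < T) :
    signedArea ε P (γ b) = signedArea ε P (γ 0) := by
  rcases hb.eq_or_lt with rfl | hb
  · rfl
  obtain ⟨t, -, h⟩ := exists_sub_eq_of_hasDerivAt hb (Icc_subset_times hT)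
    hγ.continuousOn_signedArea (fun _ => 0)
    fun t ht => hγ.hasDerivAt_signedArea ht.1 (Icc_subset_times hT ⟨ht.1.le, ht.2.le⟩).2
  linarith

theorem oscCurvature_eq (h0 : arcIntegral P (γ 0) (curvature ε (γ 0)) = 2 * Real.pi)
    {b : ℝ} (hb : 0 ≤ b) (hT : (b : EReal) < T) : oscCurvature ε P (γ b) = length P (γ b) *
      arcIntegral P (γ b) (fun u => curvature ε (γ b) u ^ 2) - 4 * Real.pi ^ 2 := by
  rw [(hγ.immersed b hb hT).oscCurvature_eq, hγ.totalCurvature_eq hb hT, h0]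
  ring

/-- As long as `K_osc ≤ 1/9`, the quantity `K_osc + 8π² log L` does not increase. -/
theorem oscCurvature_add_log_le (h0 : arcIntegral P (γ 0) (curvature ε (γ 0)) = 2 * Real.pi)
    {b : ℝ} (hb : 0 < b) (hT : (b : EReal) < T)
    (hosc : ∀ t ∈ Set.Ioo 0 b, oscCurvature ε P (γ t) ≤ 1 / 9) :
    oscCurvature ε P (γ b) + 8 * Real.pi ^ 2 * Real.log (length P (γ b))
      ≤ oscCurvature ε P (γ 0) + 8 * Real.pi ^ 2 * Real.log (length P (γ 0)) := by
  have hsub := Icc_subset_times hT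
  have hcont := (hγ.continuousOn_length.mul hγ.continuousOn_elasticEnergy).add
    ((hγ.continuousOn_length.log fun t ht =>
      (hγ.immersed t ht.1 ht.2).length_pos.ne').const_mul (8 * Real.pi ^ 2))
  obtain ⟨t, ht, h⟩ := exists_sub_eq_of_hasDerivAt hb hsub hcont _ fun t ht => by
    have hT' := (hsub ⟨ht.1.le, ht.2.le⟩).2
    have hL := hγ.hasDerivAt_length ht.1 hT'
    exact (hL.mul (hγ.hasDerivAt_elasticEnergy ht.1 hT')).add
      ((hL.log (hγ.immersed t ht.1.le hT').length_pos.ne').const_mul (8 * Real.pi ^ 2))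
  have hT' := (hsub ⟨ht.1.le, ht.2.le⟩).2
  have hc := hγ.immersed t ht.1.le hT'
  have hkd := hc.contDiff_curvature ε
  have hdd := contDiff_arcDeriv hc.smooth hc.regular hkd
  have hed := contDiff_arcDeriv hc.smooth hc.regular hdd
  have arc : ∀ {f : ℝ → ℝ}, ContDiff ℝ ∞ f → ∀ u,
      HasDerivAt f (arcDeriv (γ t) f u * speed (γ t) u) u := fun {f} hf u => by
    refine (hf.differentiable (by simp) u).hasDerivAt.congr_deriv ?_
    have := (hc.speed_pos u).ne'
    rw [arcDeriv, smul_eq_mul]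
    field_simp
  have hosct := hosc t ht
  rw [hγ.oscCurvature_eq h0 ht.1.le hT'] at hosct
  have key := curvature_interpolation hc.period_pos hc.contDiff_speed.continuous hc.speed_pos
    hed.continuous (arc hkd) (arc hdd) (hc.periodic_curvature ε).eq
    (hc.periodic_arcDeriv (hc.periodic_curvature ε)).eq
    (by
      have := hγ.totalCurvature_eq ht.1.le hT'
      rw [h0, arcIntegral] at this
      rw [this]; ring) hosct
  have hle := mul_nonpos_of_nonpos_of_nonneg key hb.le
  change _ = ((∫ u in (0 : ℝ)..P, -(arcDeriv (γ t) (curvature ε (γ t)) u ^ 2 * speed (γ t) u))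
      * (∫ u in (0 : ℝ)..P, curvature ε (γ t) u ^ 2 * speed (γ t) u)
    + (∫ u in (0 : ℝ)..P, speed (γ t) u) * _
    + _ * (_ / ∫ u in (0 : ℝ)..P, speed (γ t) u)) * b at h
  rw [← h] at hle
  simp only [Pi.add_apply, Pi.mul_apply] at hle
  rw [hγ.oscCurvature_eq h0 hb.le hT, hγ.oscCurvature_eq h0 le_rfl (hsub ⟨le_rfl, hb.le⟩).2]
  linarith

/-- The isoperimetric inequality bounds how much the length can shrink. -/
theorem log_length_sub_le {K : ℝ} (h0 : IsAdmissibleInitialCurve ε P K (γ 0))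
    {b : ℝ} (hb : 0 ≤ b) (hT : (b : EReal) < T) :
    8 * Real.pi ^ 2 * Real.log (length P (γ 0)) - 8 * Real.pi ^ 2 * Real.log (length P (γ b))
      ≤ K / 2 := by
  have hL0 := h0.immersed.length_pos
  have hLb := (hγ.immersed b hb hT).length_pos
  have hA := h0.area_pos
  have hiso := h0.iso_lt
  have hpi := Real.pi_pos
  have h1 := (hγ.immersed b hb hT).four_pi_mul_signedArea_le ε
  rw [hγ.signedArea_eq hb hT] at h1
  rw [isoRatio, div_lt_iff₀ (by positivity)] at hiso
  have h2 : length P (γ 0) ^ 2 ≤ Real.exp (K / (8 * Real.pi ^ 2)) * length P (γ b) ^ 2 :=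
    hiso.le.trans (mul_le_mul_of_nonneg_left h1 (Real.exp_pos _).le)
  have h3 := Real.log_le_log (by positivity) h2
  rw [Real.log_mul (Real.exp_pos _).ne' (by positivity), Real.log_exp, Real.log_pow,
    Real.log_pow] at h3
  push_cast at h3
  have h4 := mul_le_mul_of_nonneg_left h3 (by positivity : 0 ≤ 4 * Real.pi ^ 2)
  have h5 : 4 * Real.pi ^ 2 * (K / (8 * Real.pi ^ 2)) = K / 2 := by field_simp; ring
  linarith

/-- `K_osc` stays below `1/9`: at a first time with `K_osc ≥ 1/9` the monotone quantity and the
isoperimetric inequality would give `K_osc < 3K/2 ≤ 1/12`. -/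
theorem oscCurvature_lt {K : ℝ} (hK : K ≤ Kstar) (h0 : IsAdmissibleInitialCurve ε P K (γ 0))
    {b : ℝ} (hb : 0 ≤ b) (hT : (b : EReal) < T) : oscCurvature ε P (γ b) < 1 / 9 := by
  have hK' : K ≤ 1 / 18 := hK.trans Kstar_le
  by_contra! hcon
  have hsub := Icc_subset_times hT
  have hcont : ContinuousOn (fun t => oscCurvature ε P (γ t)) (Set.Icc 0 b) :=
    (((hγ.continuousOn_length.mul hγ.continuousOn_elasticEnergy).sub
      continuousOn_const).mono hsub).congr fun t ht =>
        hγ.oscCurvature_eq h0.total_curvature (hsub ht).1 (hsub ht).2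
  have hcomp : IsCompact (Set.Icc 0 b ∩ (fun t => oscCurvature ε P (γ t)) ⁻¹' Set.Ici (1 / 9)) :=
    isCompact_Icc.of_isClosed_subset
      (hcont.preimage_isClosed_of_isClosed isClosed_Icc isClosed_Ici) Set.inter_subset_left
  obtain ⟨t, ⟨ht, htge⟩, hleast⟩ := hcomp.exists_isLeast ⟨b, ⟨hb, le_rfl⟩, hcon⟩
  have htge : 1 / 9 ≤ oscCurvature ε P (γ t) := htge
  have hosc0 := h0.osc_lt
  have ht0 : 0 < t := by
    rcases ht.1.eq_or_lt with rfl | h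
    · linarith
    · exact h
  have hmono := hγ.oscCurvature_add_log_le h0.total_curvature ht0 (hsub ht).2 fun r hr => by
    by_contra! hr'
    exact absurd (hleast ⟨⟨hr.1.le, hr.2.le.trans ht.2⟩, hr'.le⟩) (not_le.2 hr.2)
  have hlog := hγ.log_length_sub_le h0 ht.1 (hsub ht).2
  linarith

end IsCurveDiffusionFlow

end CurveDiffusion


theorem corollary4 :
    (0 < CurveDiffusion.Kstar ∧ CurveDiffusion.Kstar < 64 - 4 * Real.pi ^ 2) ∧
    ∀ (K : ℝ), K ≤ CurveDiffusion.Kstar →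
    ∀ (ε : ℤˣ) (P : ℝ) (T : EReal) (γ₀ : ℝ → CurveDiffusion.Plane)
      (γ : ℝ → ℝ → CurveDiffusion.Plane),
      CurveDiffusion.IsAdmissibleInitialCurve ε P K γ₀ →
      CurveDiffusion.IsCurveDiffusionFlow ε P T γ →
      γ 0 = γ₀ →
      ∀ t : ℝ, 0 ≤ t → (t : EReal) < T → CurveDiffusion.IsEmbeddedCurve P (γ t) := by
  have hpi := CurveDiffusion.four_mul_pi_sq_lt
  refine ⟨⟨CurveDiffusion.Kstar_pos, ?_⟩, ?_⟩
  · linarith [CurveDiffusion.Kstar_le]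
  · rintro K hK ε P T γ₀ γ h0 hγ rfl t ht hT
    refine (hγ.immersed t ht hT).isEmbeddedCurve_of_lt ε ?_
    have h1 := hγ.oscCurvature_lt hK h0 ht hT
    rw [hγ.oscCurvature_eq h0.total_curvature ht hT] at h1
    linarith
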